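/- Conventions. Manifolds are smooth, finite-dimensional, Hausdorff and second countable. Let $\mathcal G\rightrightarrows M$ be a Lie groupoid with source $\mathsf s$, target $\mathsf t$ (both surjective submersions), unit inclusion $\iota: M\hookrightarrow\mathcal G$, inverse $\mathrm{inv}$, and composition $g\circ h$ defined if $\mathsf s(g)=\mathsf t(h)$. Let $E=\mathrm{Lie}(\mathcal G)=\mathsf T\mathcal G|_M/\mathsf TM$ be its Lie algebroid, with anchor $\alpha:E\to \mathsf TM$ induced by $\mathsf{Ts}-\mathsf{Tt}$. For a section $X\in\Gamma(E)$, let $X^L$ (resp. $X^R$) be the unique left-invariant vector field on $\mathcal G$, tangent to the target fibres (resp. right-invariant, tangent to the source fibres), whose restriction to $M$ represents $X$. The bracket on $\Gamma(E)$ is defined by $[X,Y]^L=[X^L,Y^L]$. An $E$-connection on a vector bundle $V\to M$ is an $\mathbb R$-bilinear map $\nabla:\Gamma(E)\times\Gamma(V)\to\Gamma(V)$ with $\nabla_{fX}\sigma=f\nabla_X\sigma$ and $\nabla_X(f\sigma)=f\nabla_X\sigma+\alpha(X)(f)\,\sigma$ for all $f\in C^\infty(M)$. Let $F:\mathcal G\to\mathbb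 R$ be a smooth function with $F|_M=0$ and $dF|_M=0$, and put $F^*=F\circ\mathrm{inv}$. Then $g^F(X,Y)=X^LY^LF|_M$ is a symmetric bilinear form on $E$; let $K^F=\{X\in E: g^F(X,\cdot)=0\}$ be its kernel. Suppose that $F$ is a Koszul contrast function, i.e. $K^F$ has constant rank and $$X^LY^LZ^RF|_M=0,\qquad X^LY^LZ^RF^*|_M=0\qquad\text{for all } X,Y\in\Gamma(E),\ Z\in\Gamma(K^F).$$ Let $L^F=E/K^F$, write $\bar X\in\Gamma(L^F)$ for the class of $X\in\Gamma(E)$, and let $g^{[F]}(\bar X,\bar Y)=g^F(X,Y)$ be the transversal pseudometric on $L^F$. Theorem. There are unique maps $\nabla^{[F]},\nabla^{[F^*]}:\Gamma(E)\times\Gamma(L^F)\to\Gamma(L^F)$ such that for all $X,Y,Z\in\Gamma(E)$ $$g^{[F]}(\nabla^{[F]}_X\bar Y,\bar Z)=X^LY^LZ^RF|_M,\qquad g^{[F]}(\nabla^{[F^*]}_X\bar Y,\bar Z)=X^LY^LZ^RF^*|_M .$$ Both are $E$-connections on $L^F$. They are dual with respect to $g^{[F]}$: $$\alpha(X)\,g^{[F]}(\sigma,\tau)=g^{[F]}(\nabla^{[F]}_X\sigma,\tau)+g^{[F]}(\sigma,\nabla^{[F^*]}_X\tau)\qquad\text{for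 all } X\in\Gamma(E),\ \sigma,\tau\in\Gamma(L^F).$$ Both are torsion-free in the sense that, for all $X,Y\in\Gamma(E)$, $$\nabla^{[F]}_X\bar Y-\nabla^{[F]}_Y\bar X=\overline{[X,Y]},\qquad \nabla^{[F^*]}_X\bar Y-\nabla^{[F^*]}_Y\bar X=\overline{[X,Y]} .$$ -/

import Mathlib

open scoped Manifold ContDiff Topology

noncomputable section

/-- The derivative `V f` of a real function `f` along a vector field `V`. -/
def vderiv {EG : Type*} [NormedAddCommGroup EG] [NormedSpace ℝ EG]
    {G : Type*} [TopologicalSpace G] [ChartedSpace EG G]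
    (V : ∀ g : G, TangentSpace 𝓘(ℝ, EG) g) (f : G → ℝ) (g : G) : ℝ :=
  mfderiv 𝓘(ℝ, EG) 𝓘(ℝ, ℝ) f g (V g)

/-- A Lie groupoid `G ⇉ M`. The composition `mul g h` (thought of as `g ∘ h`) is meaningful
only for composable pairs `src g = tgt h`, and every axiom only concerns such pairs; smoothness on
the set of composable pairs, which is an embedded submanifold of `G × G`, is smoothness of the
composition on this submanifold. -/
structure LieGroupoid (EG EM : Type*) [NormedAddCommGroup EG] [NormedSpace ℝ EG]
    [NormedAddCommGroup EM] [NormedSpace ℝ EM]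
    (G M : Type*) [TopologicalSpace G] [ChartedSpace EG G]
    [TopologicalSpace M] [ChartedSpace EM M] where
  /-- the inclusion of the units -/
  unit : M → G
  /-- the source map -/
  src : G → M
  /-- the target map -/
  tgt : G → M
  /-- the partial composition -/
  mul : G → G → G
  /-- the inverse -/
  inv : G → G
  src_unit : ∀ m, src (unit m) = m
  tgt_unit : ∀ m, tgt (unit m) = m
  src_mul : ∀ g h, src g = tgt h → src (mul g h) = src h
  tgt_mul : ∀ g h, src g = tgt h → tgt (mul g h) = tgt g
  mul_assoc : ∀ g h k, src g = tgt h → src h = tgt k → mul (mul g h) k = mul g (mul h k)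
  unit_mul : ∀ g, mul (unit (tgt g)) g = g
  mul_unit : ∀ g, mul g (unit (src g)) = g
  src_inv : ∀ g, src (inv g) = tgt g
  tgt_inv : ∀ g, tgt (inv g) = src g
  mul_inv : ∀ g, mul g (inv g) = unit (tgt g)
  inv_mul : ∀ g, mul (inv g) g = unit (src g)
  contMDiff_unit : ContMDiff 𝓘(ℝ, EM) 𝓘(ℝ, EG) ∞ unit
  contMDiff_src : ContMDiff 𝓘(ℝ, EG) 𝓘(ℝ, EM) ∞ src
  contMDiff_tgt : ContMDiff 𝓘(ℝ, EG) 𝓘(ℝ, EM) ∞ tgt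
  isSubmersion_src : Manifold.IsSubmersion 𝓘(ℝ, EG) 𝓘(ℝ, EM) ∞ src
  isSubmersion_tgt : Manifold.IsSubmersion 𝓘(ℝ, EG) 𝓘(ℝ, EM) ∞ tgt
  contMDiff_inv : ContMDiff 𝓘(ℝ, EG) 𝓘(ℝ, EG) ∞ inv
  contMDiffOn_mul : ContMDiffOn (𝓘(ℝ, EG).prod 𝓘(ℝ, EG)) 𝓘(ℝ, EG) ∞
    (fun p : G × G => mul p.1 p.2) {p : G × G | src p.1 = tgt p.2}

namespace LieGroupoid

variable {EG EM : Type*} [NormedAddCommGroup EG] [NormedSpace ℝ EG]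
    [NormedAddCommGroup EM] [NormedSpace ℝ EM]
    {G M : Type*} [TopologicalSpace G] [ChartedSpace EG G]
    [TopologicalSpace M] [ChartedSpace EM M]
    (𝒢 : LieGroupoid EG EM G M)

/-! ### The Lie algebroid of a Lie groupoid -/

/-- The differential of the inclusion of units at `m`. -/
def dUnit (m : M) : TangentSpace 𝓘(ℝ, EM) m →ₗ[ℝ] TangentSpace 𝓘(ℝ, EG) (𝒢.unit m) :=
  (mfderiv 𝓘(ℝ, EM) 𝓘(ℝ, EG) 𝒢.unit m).toLinearMap

/-- The differential of the source map at the unit over `m`. -/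
def dSrc (m : M) : TangentSpace 𝓘(ℝ, EG) (𝒢.unit m) →ₗ[ℝ] TangentSpace 𝓘(ℝ, EM) m :=
  (mfderiv 𝓘(ℝ, EG) 𝓘(ℝ, EM) 𝒢.src (𝒢.unit m)).toLinearMap

/-- The differential of the target map at the unit over `m`. -/
def dTgt (m : M) : TangentSpace 𝓘(ℝ, EG) (𝒢.unit m) →ₗ[ℝ] TangentSpace 𝓘(ℝ, EM) m :=
  (mfderiv 𝓘(ℝ, EG) 𝓘(ℝ, EM) 𝒢.tgt (𝒢.unit m)).toLinearMap

lemma dSrc_dUnit (m : M) (v : TangentSpace 𝓘(ℝ, EM) m) : 𝒢.dSrc m (𝒢.dUnit m v) = v := by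
  have h1 := ((𝒢.contMDiff_src.mdifferentiable (by simp)) (𝒢.unit m)).hasMFDerivAt
  have h2 := ((𝒢.contMDiff_unit.mdifferentiable (by simp)) m).hasMFDerivAt
  have h3 := h1.comp m h2
  have h4 : 𝒢.src ∘ 𝒢.unit = id := funext 𝒢.src_unit
  rw [h4] at h3
  exact DFunLike.congr_fun (hasMFDerivAt_unique h3 (hasMFDerivAt_id m)) v

lemma dTgt_dUnit (m : M) (v : TangentSpace 𝓘(ℝ, EM) m) : 𝒢.dTgt m (𝒢.dUnit m v) = v := by
  have h1 := ((𝒢.contMDiff_tgt.mdifferentiable (by simp)) (𝒢.unit m)).hasMFDerivAt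
  have h2 := ((𝒢.contMDiff_unit.mdifferentiable (by simp)) m).hasMFDerivAt
  have h3 := h1.comp m h2
  have h4 : 𝒢.tgt ∘ 𝒢.unit = id := funext 𝒢.tgt_unit
  rw [h4] at h3
  exact DFunLike.congr_fun (hasMFDerivAt_unique h3 (hasMFDerivAt_id m)) v

/-- The fibre at `m` of the Lie algebroid `E = TG|_M / TM`. -/
abbrev Fiber (m : M) : Type _ :=
  TangentSpace 𝓘(ℝ, EG) (𝒢.unit m) ⧸ LinearMap.range (𝒢.dUnit m)

/-- The anchor `E → TM`, induced by `Ts - Tt`. -/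
def anchor (m : M) : 𝒢.Fiber m →ₗ[ℝ] TangentSpace 𝓘(ℝ, EM) m :=
  (LinearMap.range (𝒢.dUnit m)).liftQ (𝒢.dSrc m - 𝒢.dTgt m) (by
    rintro _ ⟨v, rfl⟩
    simp [dSrc_dUnit, dTgt_dUnit])

/-- The unique representative of an element of `E` that is tangent to the target fibre. -/
def leftRep (m : M) : 𝒢.Fiber m →ₗ[ℝ] TangentSpace 𝓘(ℝ, EG) (𝒢.unit m) :=
  (LinearMap.range (𝒢.dUnit m)).liftQ (LinearMap.id - 𝒢.dUnit m ∘ₗ 𝒢.dTgt m) (by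
    rintro _ ⟨v, rfl⟩
    simp [dTgt_dUnit])

/-- The unique representative of an element of `E` that is tangent to the source fibre. -/
def rightRep (m : M) : 𝒢.Fiber m →ₗ[ℝ] TangentSpace 𝓘(ℝ, EG) (𝒢.unit m) :=
  (LinearMap.range (𝒢.dUnit m)).liftQ (LinearMap.id - 𝒢.dUnit m ∘ₗ 𝒢.dSrc m) (by
    rintro _ ⟨v, rfl⟩
    simp [dSrc_dUnit])

lemma mk_leftRep (m : M) (u : 𝒢.Fiber m) : Submodule.Quotient.mk (𝒢.leftRep m u) = u := by
  obtain ⟨v, rfl⟩ := Submodule.Quotient.mk_surjective _ u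
  rw [Submodule.Quotient.eq]
  exact ⟨-𝒢.dTgt m v, by simp [leftRep]⟩

lemma dTgt_leftRep (m : M) (u : 𝒢.Fiber m) : 𝒢.dTgt m (𝒢.leftRep m u) = 0 := by
  obtain ⟨v, rfl⟩ := Submodule.Quotient.mk_surjective _ u
  simp [leftRep, dTgt_dUnit]

lemma mk_rightRep (m : M) (u : 𝒢.Fiber m) : Submodule.Quotient.mk (𝒢.rightRep m u) = u := by
  obtain ⟨v, rfl⟩ := Submodule.Quotient.mk_surjective _ u
  rw [Submodule.Quotient.eq]
  exact ⟨-𝒢.dSrc m v, by simp [rightRep]⟩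

lemma dSrc_rightRep (m : M) (u : 𝒢.Fiber m) : 𝒢.dSrc m (𝒢.rightRep m u) = 0 := by
  obtain ⟨v, rfl⟩ := Submodule.Quotient.mk_surjective _ u
  simp [rightRep, dSrc_dUnit]

/-- The left-invariant vector field `X^L`: its value at `g` is the image of the representative of
`X` tangent to the target fibre through the unit over `src g` under the differential of the left
translation `h ↦ g ∘ h`, which is a map on this target fibre. (The derivative within the fibre is
only applied to a vector tangent to the fibre, where it is the differential of the
translation; the value is a tangent vector at `g ∘ unit (src g) = g`.) -/
def leftInv (X : ∀ m, 𝒢.Fiber m) (g : G) : TangentSpace 𝓘(ℝ, EG) g :=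
  (mfderivWithin 𝓘(ℝ, EG) 𝓘(ℝ, EG) (fun h => 𝒢.mul g h) {h | 𝒢.tgt h = 𝒢.src g}
    (𝒢.unit (𝒢.src g)) (𝒢.leftRep (𝒢.src g) (X (𝒢.src g))) : EG)

/-- The right-invariant vector field `X^R`, defined in the same way through the
representative of `X` tangent to the source fibre and the right translation `h ↦ h ∘ g`. -/
def rightInv (X : ∀ m, 𝒢.Fiber m) (g : G) : TangentSpace 𝓘(ℝ, EG) g :=
  (mfderivWithin 𝓘(ℝ, EG) 𝓘(ℝ, EG) (fun h => 𝒢.mul h g) {h | 𝒢.src h = 𝒢.tgt g}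
    (𝒢.unit (𝒢.tgt g)) (𝒢.rightRep (𝒢.tgt g) (X (𝒢.tgt g))) : EG)

/-- The Lie algebroid bracket, `[X, Y]^L = [X^L, Y^L]`. -/
def bracket (X Y : ∀ m, 𝒢.Fiber m) (m : M) : 𝒢.Fiber m :=
  Submodule.Quotient.mk
    (VectorField.mlieBracket 𝓘(ℝ, EG) (𝒢.leftInv X) (𝒢.leftInv Y) (𝒢.unit m))

/-- The function `α(X)(f)`, the derivative of `f` along the anchor of `X`. -/
def anchorDeriv (X : ∀ m, 𝒢.Fiber m) (f : M → ℝ) (m : M) : ℝ :=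
  mfderiv 𝓘(ℝ, EM) 𝓘(ℝ, ℝ) f m (𝒢.anchor m (X m))

/-! ### Smooth sections of the Lie algebroid -/

section Sections

variable [IsManifold 𝓘(ℝ, EG) ∞ G]

instance : IsManifold 𝓘(ℝ, EG) 1 G := IsManifold.of_le (n := ∞) (by simp)

/-- A section of `E` is smooth if its representative tangent to the target fibres is a smooth map
into `TG`. (As `v ↦ v - Tι (Tt v)` is a smooth splitting of `TG|_M → E`, this holds if and only if
the section lifts locally to smooth sections of `TG|_M`.) -/
def IsSmoothSec (X : ∀ m, 𝒢.Fiber m) : Prop :=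
  ContMDiff 𝓘(ℝ, EM) 𝓘(ℝ, EG).tangent ∞
    (fun m => (⟨𝒢.unit m, 𝒢.leftRep m (X m)⟩ : TangentBundle 𝓘(ℝ, EG) G))

lemma isSmoothSec_iff (X : ∀ m, 𝒢.Fiber m) : 𝒢.IsSmoothSec X ↔
    ∀ m₀, ContMDiffAt 𝓘(ℝ, EM) 𝓘(ℝ, EG) ∞
      (fun m => (trivializationAt EG (TangentSpace 𝓘(ℝ, EG)) (𝒢.unit m₀)
        ⟨𝒢.unit m, 𝒢.leftRep m (X m)⟩).2) m₀ := by
  refine forall_congr' fun m₀ => ?_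
  rw [Bundle.contMDiffAt_totalSpace]
  exact and_iff_right (𝒢.contMDiff_unit m₀)

lemma eventually_mem_baseSet (m₀ : M) : ∀ᶠ m in 𝓝 m₀, 𝒢.unit m ∈
    (trivializationAt EG (TangentSpace 𝓘(ℝ, EG)) (𝒢.unit m₀)).baseSet :=
  𝒢.contMDiff_unit.continuous.continuousAt.eventually
    ((trivializationAt EG (TangentSpace 𝓘(ℝ, EG)) (𝒢.unit m₀)).open_baseSet.mem_nhds
      (FiberBundle.mem_baseSet_trivializationAt' _))

lemma IsSmoothSec.add {X Y : ∀ m, 𝒢.Fiber m} (hX : 𝒢.IsSmoothSec X) (hY : 𝒢.IsSmoothSec Y) :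
    𝒢.IsSmoothSec (fun m => X m + Y m) := by
  rw [isSmoothSec_iff] at hX hY ⊢
  intro m₀
  refine ((hX m₀).add (hY m₀)).congr_of_eventuallyEq ?_
  filter_upwards [𝒢.eventually_mem_baseSet m₀] with m hm
  rw [map_add]
  exact ((trivializationAt EG (TangentSpace 𝓘(ℝ, EG)) (𝒢.unit m₀)).linear ℝ hm).1 _ _

lemma IsSmoothSec.smul {X : ∀ m, 𝒢.Fiber m} {f : M → ℝ} (hf : ContMDiff 𝓘(ℝ, EM) 𝓘(ℝ, ℝ) ∞ f)
    (hX : 𝒢.IsSmoothSec X) : 𝒢.IsSmoothSec (fun m => f m • X m) := by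
  rw [isSmoothSec_iff] at hX ⊢
  intro m₀
  refine ((hf m₀).smul (hX m₀)).congr_of_eventuallyEq ?_
  filter_upwards [𝒢.eventually_mem_baseSet m₀] with m hm
  rw [map_smul]
  exact ((trivializationAt EG (TangentSpace 𝓘(ℝ, EG)) (𝒢.unit m₀)).linear ℝ hm).2 _ _

lemma isSmoothSec_zero : 𝒢.IsSmoothSec (fun _ => 0) := by
  rw [isSmoothSec_iff]
  intro m₀
  refine (contMDiffAt_const (c := (0 : EG))).congr_of_eventuallyEq ?_
  filter_upwards [𝒢.eventually_mem_baseSet m₀] with m hm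
  rw [map_zero]
  exact ((trivializationAt EG (TangentSpace 𝓘(ℝ, EG)) (𝒢.unit m₀)).linear ℝ hm).map_zero

/-- The space `Γ(E)` of smooth sections of the Lie algebroid. -/
def Sec : Submodule ℝ (∀ m, 𝒢.Fiber m) where
  carrier := {X | 𝒢.IsSmoothSec X}
  add_mem' hX hY := IsSmoothSec.add 𝒢 hX hY
  zero_mem' := 𝒢.isSmoothSec_zero
  smul_mem' c _ hX := IsSmoothSec.smul 𝒢 (f := fun _ => c) contMDiff_const hX

/-- Multiplication of sections of `E` by smooth functions on `M`. -/
instance : SMul C^∞⟮𝓘(ℝ, EM), M; 𝓘(ℝ, ℝ), ℝ⟯ 𝒢.Sec where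
  smul f X := ⟨fun m => f m • X.1 m, IsSmoothSec.smul 𝒢 f.contMDiff X.2⟩

end Sections

/-! ### The pseudometric of a contrast function and its kernel -/

section Metric

variable [IsManifold 𝓘(ℝ, EG) ∞ G]

/-- The second derivative at `x` of a smooth function on `G`, in the chart at `x` in which tangent
vectors at `x` are expressed. If `x` is a critical point of `F`, this is the intrinsic Hessian,
`(u, v) ↦ u (Ṽ F)` for any vector field `Ṽ` extending `v`. -/
def hessian (F : C^∞⟮𝓘(ℝ, EG), G; 𝓘(ℝ, ℝ), ℝ⟯) (x : G) :
    TangentSpace 𝓘(ℝ, EG) x →ₗ[ℝ] TangentSpace 𝓘(ℝ, EG) x →ₗ[ℝ] ℝ :=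
  (LinearMap.mk₂ ℝ
    (fun u v : EG => fderiv ℝ (fderiv ℝ (F ∘ (extChartAt 𝓘(ℝ, EG) x).symm))
      (extChartAt 𝓘(ℝ, EG) x x) u v)
    (by simp) (by simp) (by simp) (by simp) : EG →ₗ[ℝ] EG →ₗ[ℝ] ℝ)

lemma hessian_symm (F : C^∞⟮𝓘(ℝ, EG), G; 𝓘(ℝ, ℝ), ℝ⟯) (x : G)
    (u v : TangentSpace 𝓘(ℝ, EG) x) : hessian F x u v = hessian F x v u := by
  have h1 : ContMDiffAt 𝓘(ℝ, EG) 𝓘(ℝ, ℝ) ∞ (F ∘ (extChartAt 𝓘(ℝ, EG) x).symm)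
      (extChartAt 𝓘(ℝ, EG) x x) :=
    F.contMDiff.contMDiffAt.comp _
      ((contMDiffOn_extChartAt_symm x).contMDiffAt (extChartAt_target_mem_nhds x))
  exact (h1.contDiffAt.isSymmSndFDerivAt (by
    simpa using (WithTop.coe_le_coe.2 le_top : ((2 : ℕ∞) : WithTop ℕ∞) ≤ ∞))) u v

/-- At a critical point `x` of `F`, `u (V F) = hessian F x u (V x)` for every vector field `V`
which is differentiable at `x`. -/
lemma mfderiv_vderiv_eq_hessian (F : C^∞⟮𝓘(ℝ, EG), G; 𝓘(ℝ, ℝ), ℝ⟯) (x : G) (hx : mfderiv 𝓘(ℝ, EG) 𝓘(ℝ, ℝ) F x = 0)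
   (V : ∀ g : G, TangentSpace 𝓘(ℝ, EG) g)
   (hV : MDifferentiableAt 𝓘(ℝ, EG) 𝓘(ℝ, EG).tangent (fun g => (⟨g, V g⟩ : TangentBundle 𝓘(ℝ, EG) G)) x)
   (u : TangentSpace 𝓘(ℝ, EG) x) :
   mfderiv 𝓘(ℝ, EG) 𝓘(ℝ, ℝ) (vderiv V F) x u = hessian F x u (V x) := by
  set φ := extChartAt 𝓘(ℝ, EG) x with hφ
  set Φ : EG → ℝ := F ∘ φ.symm with hΦ
  set W : G → EG := fun g => (trivializationAt EG (TangentSpace 𝓘(ℝ, EG)) x ⟨g, V g⟩).2 with hW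
  have hWd : MDifferentiableAt 𝓘(ℝ, EG) 𝓘(ℝ, EG) W x := by
    have := (mdifferentiableAt_totalSpace (IB := 𝓘(ℝ, EG)) (F := EG) (E := TangentSpace 𝓘(ℝ, EG)) (IM := 𝓘(ℝ, EG)) (f := (fun g => (⟨g, V g⟩ : TangentBundle 𝓘(ℝ, EG) G)))  (x₀ := x)).1 hV
    exact this.2
  -- near x, V F = fderiv Φ (φ g) (W g)
  have key : vderiv V F =ᶠ[𝓝 x] fun g => fderiv ℝ Φ (φ g) (W g) := by
    filter_upwards [extChartAt_source_mem_nhds (I := 𝓘(ℝ, EG)) x] with g hg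
    have hg' : g ∈ (chartAt EG x).source := by simpa using hg
    have h1 : MDifferentiableAt 𝓘(ℝ, EG) 𝓘(ℝ, EG) φ g := mdifferentiableAt_extChartAt hg'
    have h2 : W g = mfderiv 𝓘(ℝ, EG) 𝓘(ℝ, EG) φ g (V g) := by
      rw [hW]
      simp only
      have := TangentBundle.continuousLinearMapAt_trivializationAt (I := 𝓘(ℝ, EG)) hg'
      refine Eq.trans ?_ (DFunLike.congr_fun this (V g))
      rw [Bundle.Trivialization.continuousLinearMapAt_apply, Bundle.Trivialization.coe_linearMapAt_of_mem]
      simpa using hg'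
    have h3 : DifferentiableAt ℝ Φ (φ g) := by
      have : ContMDiffAt 𝓘(ℝ, EG) 𝓘(ℝ, ℝ) ∞ Φ (φ g) :=
        F.contMDiff.contMDiffAt.comp _
         ((contMDiffOn_extChartAt_symm x).contMDiffAt (extChartAt_target_mem_nhds' (φ.map_source hg)))
      exact (this.contDiffAt).differentiableAt (by simp)
    have h4 : F =ᶠ[𝓝 g] Φ ∘ φ := by
      filter_upwards [extChartAt_source_mem_nhds' (I := 𝓘(ℝ, EG)) hg] with y hy
      simp only [hΦ, Function.comp]
      rw [φ.left_inv hy]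
    have h5 : vderiv V F g = mfderiv 𝓘(ℝ, EG) 𝓘(ℝ, ℝ) (Φ ∘ φ) g (V g) := by
      unfold vderiv; rw [h4.mfderiv_eq]; rfl
    rw [h5, h2, mfderiv_comp g h3.mdifferentiableAt h1, mfderiv_eq_fderiv]
    rfl
  have hD : DifferentiableAt ℝ (fderiv ℝ Φ) (φ x) := by
    have : ContMDiffAt 𝓘(ℝ, EG) 𝓘(ℝ, ℝ) ∞ Φ (φ x) :=
        F.contMDiff.contMDiffAt.comp _
         ((contMDiffOn_extChartAt_symm x).contMDiffAt (extChartAt_target_mem_nhds x))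
    have h2 : (1 + 1 : WithTop ℕ∞) ≤ ∞ := by
      rw [one_add_one_eq_two]
      simpa using (WithTop.coe_le_coe.2 le_top : ((2 : ℕ∞) : WithTop ℕ∞) ≤ ∞)
    exact ((this.contDiffAt).fderiv_right (m := 1) h2).differentiableAt (by simp)
  have hφd : MDifferentiableAt 𝓘(ℝ, EG) 𝓘(ℝ, EG) φ x := mdifferentiableAt_extChartAt (by simp)
  have hφ1 : mfderiv 𝓘(ℝ, EG) 𝓘(ℝ, EG) φ x = ContinuousLinearMap.id ℝ _ := mfderiv_extChartAt_self
  have hWx : W x = V x := by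
    have := TangentBundle.continuousLinearMapAt_trivializationAt (I := 𝓘(ℝ, EG)) (x₀ := x) (x := x) (by simp)
    have e2 := DFunLike.congr_fun (this.trans hφ1) (V x)
    refine Eq.trans ?_ e2
    rw [Bundle.Trivialization.continuousLinearMapAt_apply, Bundle.Trivialization.coe_linearMapAt_of_mem]
    simp
  have hΦ0 : fderiv ℝ Φ (φ x) = 0 := by
    have h3 : ContMDiffAt 𝓘(ℝ, EG) 𝓘(ℝ, ℝ) ∞ Φ (φ x) :=
        F.contMDiff.contMDiffAt.comp _
         ((contMDiffOn_extChartAt_symm x).contMDiffAt (extChartAt_target_mem_nhds x))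
    have h4 : F =ᶠ[𝓝 x] Φ ∘ φ := by
      filter_upwards [extChartAt_source_mem_nhds (I := 𝓘(ℝ, EG)) x] with y hy
      simp only [hΦ, Function.comp]
      rw [φ.left_inv hy]
    rw [h4.mfderiv_eq, mfderiv_comp x (h3.contDiffAt.differentiableAt (by simp)).mdifferentiableAt hφd, hφ1, mfderiv_eq_fderiv] at hx
    exact hx
  have hb : DifferentiableAt ℝ (fun p : EG × EG => fderiv ℝ Φ p.1 p.2) (φ x, W x) :=
    DifferentiableAt.clm_apply (hD.comp (φ x, W x) differentiableAt_fst) differentiableAt_snd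
  rw [key.mfderiv_eq]
  have := mfderiv_comp (I := 𝓘(ℝ, EG)) (I' := 𝓘(ℝ, EG × EG)) (I'' := 𝓘(ℝ, ℝ)) x (f := fun g => (φ g, W g)) (g := (fun p : EG × EG => fderiv ℝ Φ p.1 p.2)) hb.mdifferentiableAt (hφd.prodMk_space hWd)
  refine (DFunLike.congr_fun this u).trans ?_
  have h6 : mfderiv 𝓘(ℝ, EG) 𝓘(ℝ, EG × EG) (fun g => (φ g, W g)) x = (mfderiv 𝓘(ℝ, EG) 𝓘(ℝ, EG) φ x).prod (mfderiv 𝓘(ℝ, EG) 𝓘(ℝ, EG) W x) :=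
    by
    have a1 := hφd.hasMFDerivAt
    have a2 := hWd.hasMFDerivAt
    have : HasMFDerivAt 𝓘(ℝ, EG) 𝓘(ℝ, EG × EG) (fun g => (φ g, W g)) x ((mfderiv 𝓘(ℝ, EG) 𝓘(ℝ, EG) φ x).prod (mfderiv 𝓘(ℝ, EG) 𝓘(ℝ, EG) W x)) :=
      ⟨a1.1.prodMk a2.1, a1.2.prodMk a2.2⟩
    exact this.mfderiv
  have h7 : ∀ a b : EG, fderiv ℝ (fun p : EG × EG => fderiv ℝ Φ p.1 p.2) (φ x, W x) (a, b) = fderiv ℝ (fderiv ℝ Φ) (φ x) a (W x) := by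
    intro a b
    have e0 : HasFDerivAt (fun p : EG × EG => fderiv ℝ Φ p.1) ((fderiv ℝ (fderiv ℝ Φ) (φ x)).comp (ContinuousLinearMap.fst ℝ EG EG)) (φ x, W x) :=
      HasFDerivAt.comp (g := fderiv ℝ Φ) (φ x, W x) hD.hasFDerivAt hasFDerivAt_fst
    have e := (e0.clm_apply (hasFDerivAt_snd (𝕜 := ℝ) (p := (φ x, W x)))).fderiv
    refine (DFunLike.congr_fun e (a,b)).trans ?_
    simp [hΦ0]
  rw [mfderiv_eq_fderiv, h6, hφ1]
  refine (h7 u (mfderiv 𝓘(ℝ, EG) 𝓘(ℝ, EG) W x u)).trans ?_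
  rw [hWx]
  rfl

/-- The pseudometric `g^F` on `E`, `g^F(X, Y) = X^L Y^L F` on `M`. -/
def metric (F : C^∞⟮𝓘(ℝ, EG), G; 𝓘(ℝ, ℝ), ℝ⟯) (m : M) :
    𝒢.Fiber m →ₗ[ℝ] 𝒢.Fiber m →ₗ[ℝ] ℝ :=
  (hessian F (𝒢.unit m)).compl₁₂ (𝒢.leftRep m) (𝒢.leftRep m)

lemma metric_symm (F : C^∞⟮𝓘(ℝ, EG), G; 𝓘(ℝ, ℝ), ℝ⟯) (m : M) (u v : 𝒢.Fiber m) :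
    𝒢.metric F m u v = 𝒢.metric F m v u :=
  hessian_symm F _ _ _

/-- The kernel `K^F` of `g^F`, fibrewise. -/
def kernel (F : C^∞⟮𝓘(ℝ, EG), G; 𝓘(ℝ, ℝ), ℝ⟯) (m : M) : Submodule ℝ (𝒢.Fiber m) :=
  LinearMap.ker (𝒢.metric F m)

/-- The fibre at `m` of the quotient bundle `L^F = E / K^F`. -/
abbrev QFiber (F : C^∞⟮𝓘(ℝ, EG), G; 𝓘(ℝ, ℝ), ℝ⟯) (m : M) : Type _ :=
  𝒢.Fiber m ⧸ 𝒢.kernel F m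

/-- The transversal pseudometric `g^{[F]}` on `L^F`, `g^{[F]}(X̄, Ȳ) = g^F(X, Y)`. -/
def qMetric (F : C^∞⟮𝓘(ℝ, EG), G; 𝓘(ℝ, ℝ), ℝ⟯) (m : M) :
    𝒢.QFiber F m →ₗ[ℝ] 𝒢.QFiber F m →ₗ[ℝ] ℝ :=
  (𝒢.kernel F m).liftQ
    (LinearMap.flip ((𝒢.kernel F m).liftQ (LinearMap.flip (𝒢.metric F m)) (by
      intro u hu
      have h : 𝒢.metric F m u = 0 := hu
      refine LinearMap.mem_ker.2 (LinearMap.ext fun v => ?_)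
      rw [LinearMap.flip_apply, 𝒢.metric_symm, h, LinearMap.zero_apply]))) (by
    intro u hu
    have h : 𝒢.metric F m u = 0 := hu
    refine LinearMap.mem_ker.2 (LinearMap.ext fun w => ?_)
    obtain ⟨v, rfl⟩ := Submodule.Quotient.mk_surjective _ w
    rw [LinearMap.flip_apply, Submodule.liftQ_apply, LinearMap.flip_apply, h,
      LinearMap.zero_apply, LinearMap.zero_apply])

@[simp] lemma qMetric_mk (F : C^∞⟮𝓘(ℝ, EG), G; 𝓘(ℝ, ℝ), ℝ⟯) (m : M) (u v : 𝒢.Fiber m) :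
    𝒢.qMetric F m (Submodule.Quotient.mk u) (Submodule.Quotient.mk v) = 𝒢.metric F m u v := rfl

/-- The space `Γ(L^F)` of smooth sections of `L^F`, i.e. those which lift locally to smooth
sections of `E`. -/
def QSec (F : C^∞⟮𝓘(ℝ, EG), G; 𝓘(ℝ, ℝ), ℝ⟯) : Submodule ℝ (∀ m, 𝒢.QFiber F m) where
  carrier := {σ | ∀ m₀, ∃ Y : 𝒢.Sec, ∀ᶠ m in 𝓝 m₀, σ m = Submodule.Quotient.mk (Y.1 m)}
  add_mem' {σ τ} hσ hτ m₀ := by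
    obtain ⟨Y, hY⟩ := hσ m₀
    obtain ⟨Z, hZ⟩ := hτ m₀
    refine ⟨Y + Z, ?_⟩
    filter_upwards [hY, hZ] with m h1 h2
    simp [h1, h2]
  zero_mem' m₀ := ⟨0, by simp⟩
  smul_mem' c σ hσ m₀ := by
    obtain ⟨Y, hY⟩ := hσ m₀
    refine ⟨c • Y, ?_⟩
    filter_upwards [hY] with m h1
    simp [h1]

/-- Multiplication of sections of `L^F` by smooth functions on `M`. -/
instance (F : C^∞⟮𝓘(ℝ, EG), G; 𝓘(ℝ, ℝ), ℝ⟯) :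
    SMul C^∞⟮𝓘(ℝ, EM), M; 𝓘(ℝ, ℝ), ℝ⟯ (𝒢.QSec F) where
  smul f σ := ⟨fun m => f m • σ.1 m, fun m₀ => by
    obtain ⟨Y, hY⟩ := σ.2 m₀
    refine ⟨f • Y, ?_⟩
    filter_upwards [hY] with m h1
    rw [h1]
    rfl⟩

/-- The class `X̄` in `Γ(L^F)` of a section `X` of `E`. -/
def bar (F : C^∞⟮𝓘(ℝ, EG), G; 𝓘(ℝ, ℝ), ℝ⟯) (X : 𝒢.Sec) : 𝒢.QSec F :=
  ⟨fun m => Submodule.Quotient.mk (X.1 m), fun _ => ⟨X, by simp⟩⟩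

/-! ### Koszul contrast functions and connections -/

/-- The function `F^* = F ∘ inv`. -/
def starFun (F : C^∞⟮𝓘(ℝ, EG), G; 𝓘(ℝ, ℝ), ℝ⟯) : C^∞⟮𝓘(ℝ, EG), G; 𝓘(ℝ, ℝ), ℝ⟯ :=
  ⟨F ∘ 𝒢.inv, F.contMDiff.comp 𝒢.contMDiff_inv⟩

/-- The function `X^L Y^L Z^R Φ` restricted to `M`. -/
def triple (Φ : G → ℝ) (X Y Z : ∀ m, 𝒢.Fiber m) (m : M) : ℝ :=
  vderiv (𝒢.leftInv X) (vderiv (𝒢.leftInv Y) (vderiv (𝒢.rightInv Z) Φ)) (𝒢.unit m)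

/-- `F` is a Koszul contrast function: `F` and `dF` vanish on `M`, the kernel `K^F` has constant
rank, and `X^L Y^L Z^R F = X^L Y^L Z^R F^* = 0` on `M` for all sections `X, Y` of `E` and all
sections `Z` of `K^F`. -/
structure IsKoszulContrast (F : C^∞⟮𝓘(ℝ, EG), G; 𝓘(ℝ, ℝ), ℝ⟯) : Prop where
  vanish : ∀ m, F (𝒢.unit m) = 0
  critical : ∀ m, mfderiv 𝓘(ℝ, EG) 𝓘(ℝ, ℝ) F (𝒢.unit m) = 0
  regular : ∃ r : ℕ, ∀ m, Module.finrank ℝ (𝒢.kernel F m) = r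
  koszul : ∀ X Y Z : 𝒢.Sec, (∀ m, Z.1 m ∈ 𝒢.kernel F m) →
    ∀ m, 𝒢.triple F X.1 Y.1 Z.1 m = 0
  koszul_star : ∀ X Y Z : 𝒢.Sec, (∀ m, Z.1 m ∈ 𝒢.kernel F m) →
    ∀ m, 𝒢.triple (𝒢.starFun F) X.1 Y.1 Z.1 m = 0

/-- The operator `D` on sections of `L^F` is induced by the function `Φ` (to be applied with
`Φ = F` and `Φ = F^*`):
`g^{[F]}(D_X Ȳ, Z̄) = X^L Y^L Z^R Φ` on `M`, for all sections `X, Y, Z` of `E`. -/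
def IsInducedBy (F Φ : C^∞⟮𝓘(ℝ, EG), G; 𝓘(ℝ, ℝ), ℝ⟯)
    (D : 𝒢.Sec → 𝒢.QSec F → 𝒢.QSec F) : Prop :=
  ∀ (X Y Z : 𝒢.Sec) (m : M),
    𝒢.qMetric F m ((D X (𝒢.bar F Y)).1 m) ((𝒢.bar F Z).1 m) = 𝒢.triple Φ X.1 Y.1 Z.1 m

/-- The operator `D` is an `E`-connection on `L^F`. -/
structure IsEConnection (F : C^∞⟮𝓘(ℝ, EG), G; 𝓘(ℝ, ℝ), ℝ⟯)
    (D : 𝒢.Sec → 𝒢.QSec F → 𝒢.QSec F) : Prop where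
  add_left : ∀ X Y σ, D (X + Y) σ = D X σ + D Y σ
  add_right : ∀ X σ τ, D X (σ + τ) = D X σ + D X τ
  real_smul_left : ∀ (c : ℝ) X σ, D (c • X) σ = c • D X σ
  real_smul_right : ∀ (c : ℝ) X σ, D X (c • σ) = c • D X σ
  smul_left : ∀ (f : C^∞⟮𝓘(ℝ, EM), M; 𝓘(ℝ, ℝ), ℝ⟯) X σ, D (f • X) σ = f • D X σ
  leibniz : ∀ (f : C^∞⟮𝓘(ℝ, EM), M; 𝓘(ℝ, ℝ), ℝ⟯) (X : 𝒢.Sec) (σ : 𝒢.QSec F) (m : M),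
    (D X (f • σ)).1 m = f m • (D X σ).1 m +
      𝒢.anchorDeriv X.1 f m • σ.1 m

/-- The operators `D` and `D'` on sections of `L^F` are dual with respect to `g^{[F]}`:
`α(X) g^{[F]}(σ, τ) = g^{[F]}(D_X σ, τ) + g^{[F]}(σ, D'_X τ)`. -/
def AreDual (F : C^∞⟮𝓘(ℝ, EG), G; 𝓘(ℝ, ℝ), ℝ⟯)
    (D D' : 𝒢.Sec → 𝒢.QSec F → 𝒢.QSec F) : Prop :=
  ∀ (X : 𝒢.Sec) (σ τ : 𝒢.QSec F) (m : M),
    𝒢.anchorDeriv X.1 (fun p => 𝒢.qMetric F p (σ.1 p) (τ.1 p)) m =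
      𝒢.qMetric F m ((D X σ).1 m) (τ.1 m) + 𝒢.qMetric F m (σ.1 m) ((D' X τ).1 m)

/-- The operator `D` is torsion-free: `D_X Ȳ - D_Y X̄` is the class of `[X, Y]`. -/
def IsTorsionFree (F : C^∞⟮𝓘(ℝ, EG), G; 𝓘(ℝ, ℝ), ℝ⟯)
    (D : 𝒢.Sec → 𝒢.QSec F → 𝒢.QSec F) : Prop :=
  ∀ (X Y : 𝒢.Sec) (m : M),
    (D X (𝒢.bar F Y)).1 m - (D Y (𝒢.bar F X)).1 m =
      Submodule.Quotient.mk (𝒢.bracket X.1 Y.1 m)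

end Metric

end LieGroupoid

end

/-! Since `F` is critical along `M`, its Hessian at a unit is intrinsic. It kills vectors tangent to
`M`: the function `X^L F` vanishes on `M`, hence so do its derivatives along `M`
(`hessian_dUnit_leftInv`). The Hessian therefore descends to `E`, and on `M` the functions `X^L Y^L
F`, `X^L Y^R F` and `X^R Y^R F` all equal `g^F(X, Y)`.

Left- and right-invariant fields commute, because translations on opposite sides do. So `X^L Y^L Z^R
F = Z^R X^L Y^L F` depends at a unit only on the value of `Z` there (`triple_eq_mfderiv`). By the
Koszul condition this linear form in `Z` vanishes on `K^F`, and nondegeneracy of `g^{[F]}`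
represents it by a unique vector of `L^F`. Constant rank provides local frames of `L^F`: with them
the representing section is smooth by Cramer's rule (`exists_metric_eq`), and every kernel vector
extends to a section of the kernel (`exists_kernel_sec_eq`).

At a unit, `X^L - X^R` is the image of the anchor, and inversion sends `X^L` to `-X^R`. Hence on `M`
`α(X) g^F(Y, Z) = (X^L - X^R) Y^L Z^R F = X^L Y^L Z^R F + X^L Z^L Y^R F^*` (`anchorDeriv_metric`).
This is duality. For `Y` in `K^F` it also gives `X^L Y^L Z^R F = 0`, by the Koszul condition on
`F^*`, so the connection is well defined on classes (`triple_congr_middle`). The Leibniz rule comes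
from `(fY)^L = (f ∘ s) Y^L`, torsion-freeness from `[X, Y]^L = [X^L, Y^L]`.

The hypotheses are symmetric in `F` and `F^*`, and both functions have the same metric, so one
construction serves for both. Likewise, facts on right-invariant fields are facts on left-invariant
fields of the opposite groupoid. -/

noncomputable section

/-! ### Vector fields as derivations, and their Lie bracket -/

section VectorFields

variable {EG : Type*} [NormedAddCommGroup EG] [NormedSpace ℝ EG]
  {G : Type*} [TopologicalSpace G] [ChartedSpace EG G] [IsManifold 𝓘(ℝ, EG) ∞ G]

lemma vderiv_contMDiff {V : ∀ g : G, TangentSpace 𝓘(ℝ, EG) g}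
    (hV : ContMDiff 𝓘(ℝ, EG) 𝓘(ℝ, EG).tangent ∞ (fun g => (⟨g, V g⟩ : TangentBundle 𝓘(ℝ, EG) G)))
    {f : G → ℝ} (hf : ContMDiff 𝓘(ℝ, EG) 𝓘(ℝ, ℝ) ∞ f) :
    ContMDiff 𝓘(ℝ, EG) 𝓘(ℝ, ℝ) ∞ (vderiv V f) := by
  have h1 : ContMDiff 𝓘(ℝ, EG) 𝓘(ℝ, ℝ).tangent ∞
      (tangentMap 𝓘(ℝ, EG) 𝓘(ℝ, ℝ) f ∘ fun g => (⟨g, V g⟩ : TangentBundle 𝓘(ℝ, EG) G)) :=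
    (hf.contMDiff_tangentMap (m := ∞) (by simp)).comp hV
  intro x
  have := ((Bundle.contMDiffAt_totalSpace ..).1 (h1 x)).2
  simpa [tangentMap, vderiv] using! this

/-- The derivative of a function in the direction of a Lie bracket. -/
lemma fderiv_lieBracket {Φ : EG → ℝ} {V W : EG → EG} {y : EG} (hΦ : ContDiffAt ℝ ∞ Φ y)
    (hV : DifferentiableAt ℝ V y) (hW : DifferentiableAt ℝ W y) :
    fderiv ℝ Φ y (VectorField.lieBracket ℝ V W y) =
      fderiv ℝ (fun z => fderiv ℝ Φ z (W z)) y (V y) -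
        fderiv ℝ (fun z => fderiv ℝ Φ z (V z)) y (W y) := by
  have hD : DifferentiableAt ℝ (fderiv ℝ Φ) y :=
    (hΦ.fderiv_right (m := 1) (WithTop.coe_le_coe.2 le_top)).differentiableAt (by simp)
  have hsymm := hΦ.isSymmSndFDerivAt (by
    simpa using (WithTop.coe_le_coe.2 le_top : ((2 : ℕ∞) : WithTop ℕ∞) ≤ ∞))
  -- Each iterated derivative is a second-derivative term plus a term differentiating the field; the
  -- former cancel by symmetry.
  rw [fderiv_clm_apply hD hV, fderiv_clm_apply hD hW]
  have := hsymm.eq (V y) (W y)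
  simp [VectorField.lieBracket, this]

/-- The vector field `V` in the chart at `x`. -/
def chartVectorField (x : G) (V : ∀ g : G, TangentSpace 𝓘(ℝ, EG) g) : EG → EG :=
  VectorField.mpullbackWithin 𝓘(ℝ, EG) 𝓘(ℝ, EG)
    (extChartAt 𝓘(ℝ, EG) x).symm V (Set.range 𝓘(ℝ, EG))

/-- In the chart at `x`, the derivative along `V` is the derivative along its chart
representation. -/
lemma fderiv_comp_extChartAt_symm (V : ∀ g : G, TangentSpace 𝓘(ℝ, EG) g)
    {f : G → ℝ} (hf : ContMDiff 𝓘(ℝ, EG) 𝓘(ℝ, ℝ) ∞ f) (x : G) {y : EG}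
    (hy : y ∈ (extChartAt 𝓘(ℝ, EG) x).target) :
    fderiv ℝ (f ∘ (extChartAt 𝓘(ℝ, EG) x).symm) y (chartVectorField x V y) =
    vderiv V f ((extChartAt 𝓘(ℝ, EG) x).symm y) := by
  have hinv := isInvertible_mfderivWithin_extChartAt_symm (I := 𝓘(ℝ, EG)) hy
  have hd := mdifferentiableWithinAt_extChartAt_symm (I := 𝓘(ℝ, EG)) hy
  have h1 : chartVectorField x V y = (mfderiv 𝓘(ℝ, EG) 𝓘(ℝ, EG)
      (extChartAt 𝓘(ℝ, EG) x).symm y).inverse (V ((extChartAt 𝓘(ℝ, EG) x).symm y)) := by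
    unfold chartVectorField
    rw [VectorField.mpullbackWithin_apply, modelWithCornersSelf_coe, Set.range_id,
      mfderivWithin_univ]
  rw [modelWithCornersSelf_coe, Set.range_id, mfderivWithin_univ] at hinv
  rw [modelWithCornersSelf_coe, Set.range_id, mdifferentiableWithinAt_univ] at hd
  have h2 := mfderiv_comp y (hf.mdifferentiable (by simp) _) hd
  rw [mfderiv_eq_fderiv] at h2
  rw [h1]
  refine (DFunLike.congr_fun h2 _).trans ?_
  exact congrArg (mfderiv 𝓘(ℝ, EG) 𝓘(ℝ, ℝ) f ((extChartAt 𝓘(ℝ, EG) x).symm y))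
    (DFunLike.congr_fun hinv.self_comp_inverse (V ((extChartAt 𝓘(ℝ, EG) x).symm y)))

omit [IsManifold 𝓘(ℝ, EG) ∞ G] in
lemma mfderiv_eq_fderiv_comp_extChartAt_symm {f : G → ℝ}
    (hf : ContMDiff 𝓘(ℝ, EG) 𝓘(ℝ, ℝ) ∞ f) (x : G) (v : EG) :
    (mfderiv 𝓘(ℝ, EG) 𝓘(ℝ, ℝ) f x : EG →L[ℝ] ℝ) v =
      fderiv ℝ (f ∘ (extChartAt 𝓘(ℝ, EG) x).symm) (extChartAt 𝓘(ℝ, EG) x x) v := by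
  rw [(hf.mdifferentiable (by simp) x).mfderiv, modelWithCornersSelf_coe, Set.range_id,
    fderivWithin_univ]
  rfl

lemma differentiableAt_chartVectorField [CompleteSpace EG] {V : ∀ g : G, TangentSpace 𝓘(ℝ, EG) g}
    (hV : ContMDiff 𝓘(ℝ, EG) 𝓘(ℝ, EG).tangent ∞ (fun g => (⟨g, V g⟩ : TangentBundle 𝓘(ℝ, EG) G)))
    (x : G) : DifferentiableAt ℝ (chartVectorField x V) (extChartAt 𝓘(ℝ, EG) x x) := by
  have : IsManifold 𝓘(ℝ, EG) 2 G := IsManifold.of_le (n := ∞) (WithTop.coe_le_coe.2 le_top)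
  have : DifferentiableWithinAt ℝ (chartVectorField x V) ((extChartAt 𝓘(ℝ, EG) x).symm ⁻¹'
      Set.univ ∩ Set.range 𝓘(ℝ, EG)) (extChartAt 𝓘(ℝ, EG) x x) :=
    ((hV x).mdifferentiableAt (by simp)).mdifferentiableWithinAt
      (s := Set.univ) |>.differentiableWithinAt_mpullbackWithin_vectorField
  rwa [modelWithCornersSelf_coe, Set.range_id, Set.preimage_univ, Set.univ_inter,
    differentiableWithinAt_univ] at this

lemma vderiv_vderiv_eq_fderiv [CompleteSpace EG] (V : ∀ g : G, TangentSpace 𝓘(ℝ, EG) g)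
    {W : ∀ g : G, TangentSpace 𝓘(ℝ, EG) g}
    (hW : ContMDiff 𝓘(ℝ, EG) 𝓘(ℝ, EG).tangent ∞ (fun g => (⟨g, W g⟩ : TangentBundle 𝓘(ℝ, EG) G)))
    {f : G → ℝ} (hf : ContMDiff 𝓘(ℝ, EG) 𝓘(ℝ, ℝ) ∞ f) (x : G) :
    vderiv V (vderiv W f) x = fderiv ℝ (fun y => fderiv ℝ (f ∘ (extChartAt 𝓘(ℝ, EG) x).symm) y
      (chartVectorField x W y)) (extChartAt 𝓘(ℝ, EG) x x)
      (chartVectorField x V (extChartAt 𝓘(ℝ, EG) x x)) := by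
  have e1 := fderiv_comp_extChartAt_symm V (vderiv_contMDiff hW hf) x (mem_extChartAt_target x)
  rw [extChartAt_to_inv] at e1
  rw [← e1]
  have e2 : vderiv W f ∘ (extChartAt 𝓘(ℝ, EG) x).symm =ᶠ[𝓝 (extChartAt 𝓘(ℝ, EG) x x)]
      fun y => fderiv ℝ (f ∘ (extChartAt 𝓘(ℝ, EG) x).symm) y (chartVectorField x W y) := by
    filter_upwards [extChartAt_target_mem_nhds x] with y hy
    exact (fderiv_comp_extChartAt_symm W hf x hy).symm
  rw [e2.fderiv_eq]

/-- The Lie bracket of vector fields acts on functions as the commutator. -/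
lemma mfderiv_mlieBracket [CompleteSpace EG] {V W : ∀ g : G, TangentSpace 𝓘(ℝ, EG) g}
    (hV : ContMDiff 𝓘(ℝ, EG) 𝓘(ℝ, EG).tangent ∞ (fun g => (⟨g, V g⟩ : TangentBundle 𝓘(ℝ, EG) G)))
    (hW : ContMDiff 𝓘(ℝ, EG) 𝓘(ℝ, EG).tangent ∞ (fun g => (⟨g, W g⟩ : TangentBundle 𝓘(ℝ, EG) G)))
    {f : G → ℝ} (hf : ContMDiff 𝓘(ℝ, EG) 𝓘(ℝ, ℝ) ∞ f) (x : G) :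
    mfderiv 𝓘(ℝ, EG) 𝓘(ℝ, ℝ) f x (VectorField.mlieBracket 𝓘(ℝ, EG) V W x) =
      vderiv V (vderiv W f) x - vderiv W (vderiv V f) x := by
  have hΦ : ContDiffAt ℝ ∞ (f ∘ (extChartAt 𝓘(ℝ, EG) x).symm) (extChartAt 𝓘(ℝ, EG) x x) :=
    (hf.contMDiffAt.comp _
      ((contMDiffOn_extChartAt_symm x).contMDiffAt (extChartAt_target_mem_nhds x))).contDiffAt
  have e1 : VectorField.mlieBracket 𝓘(ℝ, EG) V W x = VectorField.lieBracket ℝ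
      (chartVectorField x V) (chartVectorField x W) (extChartAt 𝓘(ℝ, EG) x x) := by
    -- The bracket is computed in the chart and carried back by the inverse of the differential of
    -- the chart, which at the centre of the chart is the identity.
    rw [← VectorField.mlieBracketWithin_univ, VectorField.mlieBracketWithin_apply,
      mfderiv_extChartAt_self, Set.preimage_univ, Set.univ_inter]
    refine (DFunLike.congr_fun (ContinuousLinearMap.inverse_id (R := ℝ) (M := EG)) _).trans ?_
    rw [ContinuousLinearMap.id_apply]
    change VectorField.lieBracketWithin ℝ (chartVectorField x V) (chartVectorField x W)
      (Set.range 𝓘(ℝ, EG)) (extChartAt 𝓘(ℝ, EG) x x) = _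
    rw [modelWithCornersSelf_coe, Set.range_id, VectorField.lieBracketWithin_univ]
  rw [vderiv_vderiv_eq_fderiv V hW hf, vderiv_vderiv_eq_fderiv W hV hf,
    ← fderiv_lieBracket hΦ (differentiableAt_chartVectorField hV x)
      (differentiableAt_chartVectorField hW x), e1]
  exact mfderiv_eq_fderiv_comp_extChartAt_symm hf x _

end VectorFields

/-! ### The opposite groupoid, inverses, and translates of curves -/

namespace LieGroupoid

section Op

variable {EG EM : Type*} [NormedAddCommGroup EG] [NormedSpace ℝ EG]
    [NormedAddCommGroup EM] [NormedSpace ℝ EM]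
    {G M : Type*} [TopologicalSpace G] [ChartedSpace EG G]
    [TopologicalSpace M] [ChartedSpace EM M]
    (𝒢 : LieGroupoid EG EM G M)

/-- The opposite Lie groupoid. Its left-invariant vector fields are the right-invariant vector
fields of `𝒢`. -/
abbrev op : LieGroupoid EG EM G M where
  unit := 𝒢.unit
  src := 𝒢.tgt
  tgt := 𝒢.src
  mul g h := 𝒢.mul h g
  inv := 𝒢.inv
  src_unit := 𝒢.tgt_unit
  tgt_unit := 𝒢.src_unit
  src_mul g h e := 𝒢.tgt_mul h g e.symm
  tgt_mul g h e := 𝒢.src_mul h g e.symm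
  mul_assoc g h k e e' := (𝒢.mul_assoc k h g e'.symm e.symm).symm
  unit_mul := 𝒢.mul_unit
  mul_unit := 𝒢.unit_mul
  src_inv := 𝒢.tgt_inv
  tgt_inv := 𝒢.src_inv
  mul_inv := 𝒢.inv_mul
  inv_mul := 𝒢.mul_inv
  contMDiff_unit := 𝒢.contMDiff_unit
  contMDiff_src := 𝒢.contMDiff_tgt
  contMDiff_tgt := 𝒢.contMDiff_src
  isSubmersion_src := 𝒢.isSubmersion_tgt
  isSubmersion_tgt := 𝒢.isSubmersion_src
  contMDiff_inv := 𝒢.contMDiff_inv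
  contMDiffOn_mul := 𝒢.contMDiffOn_mul.comp (t := {p : G × G | 𝒢.src p.1 = 𝒢.tgt p.2})
    (contMDiff_snd.prodMk contMDiff_fst).contMDiffOn fun _ hp => (Eq.symm hp)


lemma eq_inv_of_mul_eq_unit {g h : G} (hgh : 𝒢.src g = 𝒢.tgt h)
    (e : 𝒢.mul g h = 𝒢.unit (𝒢.tgt g)) : h = 𝒢.inv g := by
  have h1 := 𝒢.mul_assoc (𝒢.inv g) g h (𝒢.src_inv g) hgh
  rwa [e, 𝒢.inv_mul, hgh, 𝒢.unit_mul, ← 𝒢.src_inv, 𝒢.mul_unit] at h1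

lemma inv_unit (m : M) : 𝒢.inv (𝒢.unit m) = 𝒢.unit m := by
  refine (𝒢.eq_inv_of_mul_eq_unit (by simp [𝒢.src_unit, 𝒢.tgt_unit]) ?_).symm
  have := 𝒢.mul_unit (𝒢.unit m)
  rw [𝒢.src_unit] at this
  rw [this, 𝒢.tgt_unit]

lemma inv_inv (g : G) : 𝒢.inv (𝒢.inv g) = g :=
  (𝒢.eq_inv_of_mul_eq_unit (𝒢.src_inv g) (by rw [𝒢.inv_mul, 𝒢.tgt_inv])).symm

lemma inv_mul_rev {g h : G} (e : 𝒢.src g = 𝒢.tgt h) :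
    𝒢.inv (𝒢.mul g h) = 𝒢.mul (𝒢.inv h) (𝒢.inv g) := by
  have e1 : 𝒢.src (𝒢.inv h) = 𝒢.tgt (𝒢.inv g) := by rw [𝒢.src_inv, 𝒢.tgt_inv, e]
  refine (𝒢.eq_inv_of_mul_eq_unit ?_ ?_).symm
  · rw [𝒢.src_mul _ _ e, 𝒢.tgt_mul _ _ e1, 𝒢.tgt_inv]
  · rw [𝒢.mul_assoc _ _ _ e (by rw [𝒢.tgt_mul _ _ e1, 𝒢.tgt_inv]),
      ← 𝒢.mul_assoc _ _ _ (𝒢.tgt_inv h).symm e1, 𝒢.mul_inv, ← e, ← 𝒢.tgt_inv, 𝒢.unit_mul,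
      𝒢.mul_inv, 𝒢.tgt_mul _ _ e]

/-- The composition of smooth families of composable arrows is smooth. -/
lemma contMDiffAt_mul {EN HN : Type*} [NormedAddCommGroup EN] [NormedSpace ℝ EN]
    [TopologicalSpace HN] {I : ModelWithCorners ℝ EN HN} {N : Type*} [TopologicalSpace N]
    [ChartedSpace HN N] {a b : N → G} {x : N} (ha : ContMDiffAt I 𝓘(ℝ, EG) ∞ a x)
    (hb : ContMDiffAt I 𝓘(ℝ, EG) ∞ b x) (hab : ∀ᶠ y in 𝓝 x, 𝒢.src (a y) = 𝒢.tgt (b y)) :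
    ContMDiffAt I 𝓘(ℝ, EG) ∞ (fun y => 𝒢.mul (a y) (b y)) x := by
  have h1 : ContMDiffWithinAt I (𝓘(ℝ, EG).prod 𝓘(ℝ, EG)) ∞ (fun y => (a y, b y))
    {y | 𝒢.src (a y) = 𝒢.tgt (b y)} x := (ha.prodMk hb).contMDiffWithinAt
  -- Composability holds near `x`, so smoothness within the composable locus is smoothness at `x`.
  exact (ContMDiffWithinAt.comp x (𝒢.contMDiffOn_mul _ hab.self_of_nhds) h1
    (fun y hy => hy)).contMDiffAt hab

/-- Two representatives of one class differ by a vector tangent to the units, and `dSrc`, which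
kills `rightRep`, determines that vector. -/
lemma rightRep_eq_leftRep_sub (m : M) (u : 𝒢.Fiber m) : 𝒢.rightRep m u =
    𝒢.leftRep m u - 𝒢.dUnit m (𝒢.dSrc m (𝒢.leftRep m u)) := by
  conv_lhs => rw [← 𝒢.mk_leftRep m u]
  rfl

lemma dSrc_leftRep (m : M) (u : 𝒢.Fiber m) :
    𝒢.dSrc m (𝒢.leftRep m u) = 𝒢.anchor m u := by
  conv_rhs => rw [← 𝒢.mk_leftRep m u]
  change _ = 𝒢.dSrc m (𝒢.leftRep m u) - 𝒢.dTgt m (𝒢.leftRep m u)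
  rw [dTgt_leftRep, sub_zero]

lemma rightRep_eq (m : M) (u : 𝒢.Fiber m) : 𝒢.rightRep m u =
    𝒢.leftRep m u - 𝒢.dUnit m (𝒢.anchor m u) := by
  rw [rightRep_eq_leftRep_sub, dSrc_leftRep]

section LeftInv

variable (X : ∀ m, 𝒢.Fiber m) (g : G)

/-- Guarantees that the `mfderivWithin` in `leftInv` is a genuine derivative and not the default
value zero. -/
lemma mdifferentiableWithinAt_mul_left : MDifferentiableWithinAt 𝓘(ℝ, EG) 𝓘(ℝ, EG)
    (fun h => 𝒢.mul g h) {h | 𝒢.tgt h = 𝒢.src g} (𝒢.unit (𝒢.src g)) := by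
  have h1 : ContMDiffWithinAt 𝓘(ℝ, EG) (𝓘(ℝ, EG).prod 𝓘(ℝ, EG)) ∞ (fun h : G => (g, h))
    {h | 𝒢.tgt h = 𝒢.src g} (𝒢.unit (𝒢.src g)) :=
    (contMDiffAt_const.prodMk contMDiffAt_id).contMDiffWithinAt
  have h2 := ContMDiffWithinAt.comp (t := {p : G × G | 𝒢.src p.1 = 𝒢.tgt p.2})
    (𝒢.unit (𝒢.src g))
    (𝒢.contMDiffOn_mul (g, 𝒢.unit (𝒢.src g)) (𝒢.tgt_unit _).symm) h1
    (fun y (hy : 𝒢.tgt y = 𝒢.src g) => hy.symm)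
  exact h2.mdifferentiableWithinAt (by simp)

/-- The value of a left-invariant vector field is the velocity of the left translate of any
curve in the target fibre which represents the section. -/
lemma hasMFDerivAt_mul_curve {h : ℝ → G} (hd : MDifferentiableAt 𝓘(ℝ, ℝ) 𝓘(ℝ, EG) h 0)
    (h0 : h 0 = 𝒢.unit (𝒢.src g)) (ht : ∀ᶠ δ in 𝓝 (0 : ℝ), 𝒢.tgt (h δ) = 𝒢.src g)
    (hv : (mfderiv 𝓘(ℝ, ℝ) 𝓘(ℝ, EG) h 0 : ℝ →L[ℝ] EG) 1 = 𝒢.leftRep _ (X (𝒢.src g))) :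
    HasMFDerivAt 𝓘(ℝ, ℝ) 𝓘(ℝ, EG) (fun δ => 𝒢.mul g (h δ)) 0
      (ContinuousLinearMap.toSpanSingleton ℝ (𝒢.leftInv X g : EG) : ℝ →L[ℝ] EG) := by
  -- A derivative within the fibre need not be unique off the vectors tangent to the fibre. The
  -- chain rule along a curve inside the fibre holds for whichever derivative `L` was chosen.
  set L : EG →L[ℝ] EG := mfderivWithin 𝓘(ℝ, EG) 𝓘(ℝ, EG)
    (fun h => 𝒢.mul g h) {h | 𝒢.tgt h = 𝒢.src g} (𝒢.unit (𝒢.src g)) with hL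
  have h1 : HasMFDerivWithinAt 𝓘(ℝ, EG) 𝓘(ℝ, EG) (fun h => 𝒢.mul g h) {h | 𝒢.tgt h = 𝒢.src g}
      (h 0) L := by
    rw [h0]
    exact (𝒢.mdifferentiableWithinAt_mul_left g).hasMFDerivWithinAt
  have h2 := (HasMFDerivWithinAt.comp (0 : ℝ) h1
    (hd.hasMFDerivAt.hasMFDerivWithinAt (s := {δ | 𝒢.tgt (h δ) = 𝒢.src g}))
    (fun y hy => hy)).hasMFDerivAt ht
  have h3 : (ContinuousLinearMap.toSpanSingleton ℝ (𝒢.leftInv X g : EG) : ℝ →L[ℝ] EG) =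
      L ∘L (mfderiv 𝓘(ℝ, ℝ) 𝓘(ℝ, EG) h 0 : ℝ →L[ℝ] EG) := by
    refine ContinuousLinearMap.ext_ring (R₁ := ℝ) (M₁ := EG) ?_
    exact (one_smul ℝ (𝒢.leftInv X g : EG)).trans (congrArg L hv).symm
  rw [h3]
  exact h2

lemma leftInv_add (Y : ∀ m, 𝒢.Fiber m) :
    (𝒢.leftInv (fun m => X m + Y m) g : EG) = (𝒢.leftInv X g : EG) + (𝒢.leftInv Y g : EG) := by
  unfold leftInv
  rw [map_add]
  exact map_add (mfderivWithin 𝓘(ℝ, EG) 𝓘(ℝ, EG)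
    (fun h => 𝒢.mul g h) {h | 𝒢.tgt h = 𝒢.src g} (𝒢.unit (𝒢.src g))) _ _

lemma leftInv_smul (f : M → ℝ) :
    (𝒢.leftInv (fun m => f m • X m) g : EG) = f (𝒢.src g) • (𝒢.leftInv X g : EG) := by
  unfold leftInv
  rw [map_smul]
  exact map_smul (mfderivWithin 𝓘(ℝ, EG) 𝓘(ℝ, EG)
    (fun h => 𝒢.mul g h) {h | 𝒢.tgt h = 𝒢.src g} (𝒢.unit (𝒢.src g))) _ _

end LeftInv

end Op

end LieGroupoid

/-! ### Smooth families of curves in the target fibres -/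

namespace LieGroupoid

section Curves

variable {EG EM : Type*} [NormedAddCommGroup EG] [NormedSpace ℝ EG]
    [NormedAddCommGroup EM] [NormedSpace ℝ EM]
    {G M : Type*} [TopologicalSpace G] [ChartedSpace EG G] [IsManifold 𝓘(ℝ, EG) ∞ G]
    [TopologicalSpace M] [ChartedSpace EM M]
    (𝒢 : LieGroupoid EG EM G M)

/-- A smooth family of curves in the target fibres, representing a smooth section of `E`. -/
lemma exists_curves {X : ∀ m, 𝒢.Fiber m} (hX : 𝒢.IsSmoothSec X) (m₀ : M) :
    ∃ H : M × ℝ → G, ContMDiffAt (𝓘(ℝ, EM).prod 𝓘(ℝ, ℝ)) 𝓘(ℝ, EG) ∞ H (m₀, 0) ∧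
      (∀ᶠ p in 𝓝 (m₀, (0 : ℝ)), 𝒢.tgt (H p) = p.1) ∧
      ∀ᶠ m in 𝓝 m₀, H (m, 0) = 𝒢.unit m ∧
        HasMFDerivAt 𝓘(ℝ, ℝ) 𝓘(ℝ, EG) (fun δ => H (m, δ)) 0
          (ContinuousLinearMap.toSpanSingleton ℝ (𝒢.leftRep m (X m) : EG) : ℝ →L[ℝ] EG) := by
  -- In charts adapted to the submersion the target map is a linear projection `q`, so a straight
  -- line with direction in the kernel of `q` stays in one target fibre.
  obtain ⟨F, _, _, h⟩ := 𝒢.isSubmersion_tgt.isSubmersionAt (𝒢.unit m₀)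
  set e := h.domChart
  set c := h.codChart
  set q : EG →L[ℝ] EM := (ContinuousLinearMap.fst ℝ EM F) ∘L (h.equiv : EG →L[ℝ] EM × F)
  have he := h.domChart_mem_maximalAtlas
  have hc := h.codChart_mem_maximalAtlas
  have hq : ∀ g ∈ e.source, c (𝒢.tgt g) = q (e g) := by
    intro g hg
    have hm : e g ∈ (e.extend 𝓘(ℝ, EG)).target := by simpa using e.map_source hg
    have := h.writtenInCharts hm
    simpa [e, e.left_inv hg] using! this
  have hu : ∀ᶠ m in 𝓝 m₀, 𝒢.unit m ∈ e.source :=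
    𝒢.contMDiff_unit.continuous.continuousAt.eventually
      (e.open_source.mem_nhds h.mem_domChart_source)
  -- `D m` is the left representative of `X m` read in the chart; it lies in the kernel of `q`
  -- because `dTgt` kills the representative (`hqD`).
  set D : M → EG := fun m => (mfderivWithin 𝓘(ℝ, EG) 𝓘(ℝ, EG) e e.source (𝒢.unit m) :
    EG →L[ℝ] EG) (𝒢.leftRep m (X m))
  have hDsm : ContMDiffAt 𝓘(ℝ, EM) 𝓘(ℝ, EG) ∞ D m₀ := by
    have h1 := ((contMDiffOn_of_mem_maximalAtlas he).contMDiffOn_tangentMapWithin (m := ∞)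
      (by simp) e.open_source.uniqueMDiffOn)
    have h2 := ((h1 ⟨𝒢.unit m₀, 𝒢.leftRep m₀ (X m₀)⟩ h.mem_domChart_source).contMDiffAt
      ((e.open_source.preimage (FiberBundle.continuous_proj EG _)).mem_nhds
        h.mem_domChart_source)).comp m₀ (hX m₀)
    exact (contMDiff_snd_tangentBundle_modelSpace EG 𝓘(ℝ, EG)).contMDiffAt.comp m₀ h2
  have hφ : ContMDiffAt 𝓘(ℝ, EM) 𝓘(ℝ, EG) ∞ (fun m => e (𝒢.unit m)) m₀ :=
    ((contMDiffOn_of_mem_maximalAtlas he).contMDiffAt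
      (e.open_source.mem_nhds h.mem_domChart_source)).comp m₀ (𝒢.contMDiff_unit m₀)
  have hy : ContMDiffAt (𝓘(ℝ, EM).prod 𝓘(ℝ, ℝ)) 𝓘(ℝ, EG) ∞
      (fun p : M × ℝ => e (𝒢.unit p.1) + p.2 • D p.1) (m₀, 0) :=
    (hφ.comp (m₀, (0 : ℝ)) contMDiffAt_fst).add
      (contMDiffAt_snd.smul (hDsm.comp (m₀, (0 : ℝ)) contMDiffAt_fst))
  have ht0 : e (𝒢.unit m₀) + (0 : ℝ) • D m₀ ∈ e.target := by
    rw [zero_smul, add_zero]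
    exact e.map_source h.mem_domChart_source
  have hyt : ∀ᶠ p in 𝓝 (m₀, (0 : ℝ)), e (𝒢.unit p.1) + p.2 • D p.1 ∈ e.target :=
    hy.continuousAt.eventually (e.open_target.mem_nhds ht0)
  have hDm : ∀ m, 𝒢.unit m ∈ e.source → D m =
      (mfderiv 𝓘(ℝ, EG) 𝓘(ℝ, EG) e (𝒢.unit m) : EG →L[ℝ] EG) (𝒢.leftRep m (X m)) := by
    intro m hm
    have := mfderivWithin_of_isOpen (I := 𝓘(ℝ, EG)) (I' := 𝓘(ℝ, EG)) (f := e) e.open_source hm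
    exact DFunLike.congr_fun this (𝒢.leftRep m (X m))
  have hqD : ∀ m, 𝒢.unit m ∈ e.source → q (D m) = 0 := by
    intro m hm
    have he1 : MDifferentiableAt 𝓘(ℝ, EG) 𝓘(ℝ, EG) e (𝒢.unit m) :=
      ((contMDiffOn_of_mem_maximalAtlas he).contMDiffAt
        (e.open_source.mem_nhds hm)).mdifferentiableAt (by simp)
    have hcs : 𝒢.tgt (𝒢.unit m) ∈ c.source := h.source_subset_preimage_source hm
    have hc1 : MDifferentiableAt 𝓘(ℝ, EM) 𝓘(ℝ, EM) c (𝒢.tgt (𝒢.unit m)) :=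
      ((contMDiffOn_of_mem_maximalAtlas hc).contMDiffAt
        (c.open_source.mem_nhds hcs)).mdifferentiableAt (by simp)
    have e1 : HasMFDerivAt 𝓘(ℝ, EG) 𝓘(ℝ, EM) (c ∘ 𝒢.tgt) (𝒢.unit m) _ :=
      HasMFDerivAt.comp _ hc1.hasMFDerivAt
        ((𝒢.contMDiff_tgt.mdifferentiable (by simp)) (𝒢.unit m)).hasMFDerivAt
    have e2 : HasMFDerivAt 𝓘(ℝ, EG) 𝓘(ℝ, EM) (q ∘ e) (𝒢.unit m) _ :=
      HasMFDerivAt.comp _ q.hasMFDerivAt he1.hasMFDerivAt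
    have e3 : (c ∘ 𝒢.tgt) =ᶠ[𝓝 (𝒢.unit m)] (q ∘ e) := by
      filter_upwards [e.open_source.mem_nhds hm] with g hg using hq g hg
    have e4 := hasMFDerivAt_unique (e1.congr_of_eventuallyEq e3.symm) e2
    have e5 := DFunLike.congr_fun e4 (𝒢.leftRep m (X m))
    rw [hDm m hm]
    refine e5.symm.trans ?_
    have e6 := 𝒢.dTgt_leftRep m (X m)
    exact (congrArg (mfderiv 𝓘(ℝ, EM) 𝓘(ℝ, EM) c (𝒢.tgt (𝒢.unit m))) e6).trans (map_zero _)
  refine ⟨fun p => e.symm (e (𝒢.unit p.1) + p.2 • D p.1), ?_, ?_, ?_⟩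
  · exact ((contMDiffOn_symm_of_mem_maximalAtlas he).contMDiffAt
      (e.open_target.mem_nhds ht0)).comp (m₀, (0 : ℝ)) hy
  · filter_upwards [hyt, (continuous_fst.continuousAt (x := (m₀, (0 : ℝ)))).eventually hu]
      with p hp hp1
    -- Both base points lie in the chart `c`, where injectivity reduces the claim to `q (D p.1) =
    -- 0`.
    have hs := e.map_target hp
    refine c.injOn (h.source_subset_preimage_source hs) ?_ ?_
    · rw [← 𝒢.tgt_unit p.1]
      exact h.source_subset_preimage_source hp1
    · rw [hq _ hs, e.right_inv hp, map_add, map_smul, hqD _ hp1, smul_zero, add_zero,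
        ← hq _ hp1, 𝒢.tgt_unit]
  · filter_upwards [hu] with m hm
    refine ⟨by simp [e.left_inv hm], ?_⟩
    have he1 : MDifferentiableAt 𝓘(ℝ, EG) 𝓘(ℝ, EG) e (𝒢.unit m) :=
      ((contMDiffOn_of_mem_maximalAtlas he).contMDiffAt
        (e.open_source.mem_nhds hm)).mdifferentiableAt (by simp)
    have he2 : MDifferentiableAt 𝓘(ℝ, EG) 𝓘(ℝ, EG) e.symm (e (𝒢.unit m)) :=
      ((contMDiffOn_symm_of_mem_maximalAtlas he).contMDiffAt
        (e.open_target.mem_nhds (e.map_source hm))).mdifferentiableAt (by simp)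
    have e1 : HasMFDerivAt 𝓘(ℝ, EG) 𝓘(ℝ, EG) (e.symm ∘ e) (𝒢.unit m) _ :=
      HasMFDerivAt.comp _ he2.hasMFDerivAt he1.hasMFDerivAt
    have e3 : (e.symm ∘ e) =ᶠ[𝓝 (𝒢.unit m)] id := by
      filter_upwards [e.open_source.mem_nhds hm] with g hg using e.left_inv hg
    have e4 := hasMFDerivAt_unique (e1.congr_of_eventuallyEq e3.symm) (hasMFDerivAt_id _)
    set S : EG →L[ℝ] EG := mfderiv 𝓘(ℝ, EG) 𝓘(ℝ, EG) e.symm (e (𝒢.unit m))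
    have e5 : S (D m) = 𝒢.leftRep m (X m) := by
      rw [hDm m hm]
      exact DFunLike.congr_fun e4 (𝒢.leftRep m (X m))
    have hl : HasFDerivAt (fun δ : ℝ => e (𝒢.unit m) + δ • D m)
        (ContinuousLinearMap.toSpanSingleton ℝ (D m)) 0 :=
      ((ContinuousLinearMap.toSpanSingleton ℝ (D m)).hasFDerivAt).const_add _
    have h2' : HasMFDerivAt 𝓘(ℝ, EG) 𝓘(ℝ, EG) e.symm (e (𝒢.unit m) + (0 : ℝ) • D m) S := by
      rw [zero_smul, add_zero]
      exact he2.hasMFDerivAt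
    have h3 := HasMFDerivAt.comp (0 : ℝ) h2' hl.hasMFDerivAt
    have h4 : (ContinuousLinearMap.toSpanSingleton ℝ (𝒢.leftRep m (X m) : EG) : ℝ →L[ℝ] EG) =
        S ∘L ContinuousLinearMap.toSpanSingleton ℝ (D m) := by
      refine ContinuousLinearMap.ext_ring (R₁ := ℝ) (M₁ := EG) ?_
      refine (one_smul ℝ (𝒢.leftRep m (X m) : EG)).trans (e5.symm.trans ?_)
      exact (congrArg S (one_smul ℝ (D m))).symm
    rw [h4]
    exact h3

end Curves
end LieGroupoid

/-- Every tangent space is by definition the model space, so vectors over equal base points can be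
compared without transport. -/
lemma TangentBundle.mk_eq_mk {E : Type*} [NormedAddCommGroup E] [NormedSpace ℝ E]
    {N : Type*} [TopologicalSpace N] [ChartedSpace E N] {a b : N} {u v : E} (hab : a = b)
    (huv : u = v) : (⟨a, u⟩ : TangentBundle 𝓘(ℝ, E) N) = ⟨b, v⟩ := by
  subst hab huv
  rfl

/-- Mixed partial derivatives of a smooth function of two variables commute. -/
lemma deriv_deriv_comm {Φ : ℝ × ℝ → ℝ} (hΦ : ContDiffAt ℝ ∞ Φ (0, 0)) :
    deriv (fun ε => deriv (fun δ => Φ (ε, δ)) 0) 0 =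
      deriv (fun δ => deriv (fun ε => Φ (ε, δ)) 0) 0 := by
  have hsymm := hΦ.isSymmSndFDerivAt (by
    simpa using (WithTop.coe_le_coe.2 le_top : ((2 : ℕ∞) : WithTop ℕ∞) ≤ ∞))
  have hD : DifferentiableAt ℝ (fderiv ℝ Φ) (0, 0) :=
    (hΦ.fderiv_right (m := 1) (WithTop.coe_le_coe.2 le_top)).differentiableAt (by simp)
  have hev : ∀ᶠ p in 𝓝 ((0 : ℝ), (0 : ℝ)), DifferentiableAt ℝ Φ p := by
    have := (hΦ.of_le (m := 1) (WithTop.coe_le_coe.2 le_top)).eventually (by simp)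
    filter_upwards [this] with p hp using hp.differentiableAt (by simp)
  have hl : ∀ c : ℝ, HasDerivAt (fun t : ℝ => (t, c)) (1, 0) 0 := fun c =>
    (hasDerivAt_id _).prodMk (hasDerivAt_const _ _)
  have hr : ∀ c : ℝ, HasDerivAt (fun t : ℝ => (c, t)) (0, 1) 0 := fun c =>
    (hasDerivAt_const _ _).prodMk (hasDerivAt_id _)
  have e1 : (fun ε => deriv (fun δ => Φ (ε, δ)) 0) =ᶠ[𝓝 0] fun ε => fderiv ℝ Φ (ε, 0) (0, 1) := by
    filter_upwards [(hl 0).continuousAt.eventually hev] with ε hε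
    exact (hε.hasFDerivAt.comp_hasDerivAt (0 : ℝ) (hr ε)).deriv
  have e2 : (fun δ => deriv (fun ε => Φ (ε, δ)) 0) =ᶠ[𝓝 0] fun δ => fderiv ℝ Φ (0, δ) (1, 0) := by
    filter_upwards [(hr 0).continuousAt.eventually hev] with δ hδ
    exact (hδ.hasFDerivAt.comp_hasDerivAt (0 : ℝ) (hl δ)).deriv
  have d1 : HasDerivAt (fun t : ℝ => fderiv ℝ Φ (t, 0))
      (fderiv ℝ (fderiv ℝ Φ) (0, 0) (1, 0)) 0 :=
    HasFDerivAt.comp_hasDerivAt (f := fun t : ℝ => (t, (0 : ℝ))) (0 : ℝ) hD.hasFDerivAt (hl 0)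
  have d2 : HasDerivAt (fun t : ℝ => fderiv ℝ Φ (0, t))
      (fderiv ℝ (fderiv ℝ Φ) (0, 0) (0, 1)) 0 :=
    HasFDerivAt.comp_hasDerivAt (f := fun t : ℝ => ((0 : ℝ), t)) (0 : ℝ) hD.hasFDerivAt (hr 0)
  rw [e1.deriv_eq, e2.deriv_eq,
    (d1.clm_apply (hasDerivAt_const (0 : ℝ) ((0 : ℝ), (1 : ℝ)))).deriv,
    (d2.clm_apply (hasDerivAt_const (0 : ℝ) ((1 : ℝ), (0 : ℝ)))).deriv]
  simpa using hsymm.eq (1, 0) (0, 1)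

/-! ### Smoothness and commutation of invariant vector fields -/

namespace LieGroupoid

section Invariant

variable {EG EM : Type*} [NormedAddCommGroup EG] [NormedSpace ℝ EG]
    [NormedAddCommGroup EM] [NormedSpace ℝ EM]
    {G M : Type*} [TopologicalSpace G] [ChartedSpace EG G] [IsManifold 𝓘(ℝ, EG) ∞ G]
    [TopologicalSpace M] [ChartedSpace EM M]
    (𝒢 : LieGroupoid EG EM G M)

/-- Left-invariant vector fields of smooth sections are smooth. -/
lemma contMDiff_leftInv {X : ∀ m, 𝒢.Fiber m} (hX : 𝒢.IsSmoothSec X) :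
    ContMDiff 𝓘(ℝ, EG) 𝓘(ℝ, EG).tangent ∞
      (fun g => (⟨g, 𝒢.leftInv X g⟩ : TangentBundle 𝓘(ℝ, EG) G)) := by
  intro g₀
  obtain ⟨H, hH, hHt, hH0⟩ := 𝒢.exists_curves hX (𝒢.src g₀)
  -- `K` is jointly smooth and its velocity at `δ = 0` is `X^L`. Differentiation in `δ` preserves
  -- smoothness in `g`, which gives the claim after evaluation at the constant vector `1`.
  set K : G → ℝ → G := fun g δ => 𝒢.mul g (H (𝒢.src g, δ)) with hK
  have hc : ContMDiffAt (𝓘(ℝ, EG).prod 𝓘(ℝ, ℝ)) (𝓘(ℝ, EM).prod 𝓘(ℝ, ℝ)) ∞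
      (fun p : G × ℝ => (𝒢.src p.1, p.2)) (g₀, 0) :=
    (𝒢.contMDiff_src.contMDiffAt.comp (g₀, (0 : ℝ)) contMDiffAt_fst).prodMk contMDiffAt_snd
  have hKs : ContMDiffAt (𝓘(ℝ, EG).prod 𝓘(ℝ, ℝ)) 𝓘(ℝ, EG) ∞ (Function.uncurry K) (g₀, 0) := by
    refine 𝒢.contMDiffAt_mul contMDiffAt_fst (hH.comp (g₀, (0 : ℝ)) hc) ?_
    filter_upwards [hc.continuousAt.eventually hHt] with p hp using hp.symm
  have hKd := ContMDiffAt.mfderiv (m := ∞) K (fun _ => (0 : ℝ)) hKs contMDiffAt_const (by simp)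
  have hev : ∀ᶠ g in 𝓝 g₀, ∀ᶠ δ in 𝓝 (0 : ℝ), 𝒢.tgt (H (𝒢.src g, δ)) = 𝒢.src g := by
    have := hc.continuousAt.eventually hHt
    rw [nhds_prod_eq] at this
    exact this.curry
  have hK0 : ∀ᶠ g in 𝓝 g₀, K g 0 = g ∧ (mfderiv 𝓘(ℝ, ℝ) 𝓘(ℝ, EG) (K g) 0 : ℝ →L[ℝ] EG) 1 =
      (𝒢.leftInv X g : EG) := by
    filter_upwards [𝒢.contMDiff_src.continuous.continuousAt.eventually hH0, hev] with g hg ht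
    refine ⟨by simp only [hK, hg.1, 𝒢.mul_unit], ?_⟩
    have h1 : (mfderiv 𝓘(ℝ, ℝ) 𝓘(ℝ, EG) (fun δ => H (𝒢.src g, δ)) 0 : ℝ →L[ℝ] EG) 1 =
        𝒢.leftRep _ (X (𝒢.src g)) :=
      (DFunLike.congr_fun hg.2.mfderiv (1 : ℝ)).trans (one_smul ℝ (𝒢.leftRep _ (X (𝒢.src g)) : EG))
    exact (DFunLike.congr_fun (𝒢.hasMFDerivAt_mul_curve X g hg.2.mdifferentiableAt hg.1 ht
      h1).mfderiv (1 : ℝ)).trans (one_smul ℝ (𝒢.leftInv X g : EG))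
  have h1 : ContMDiffAt 𝓘(ℝ, EG) 𝓘(ℝ, ℝ).tangent ∞
      (fun _ : G => (⟨0, (1 : ℝ)⟩ : TangentBundle 𝓘(ℝ, ℝ) ℝ)) g₀ := contMDiffAt_const
  have h2 : ContMDiffAt 𝓘(ℝ, EG) 𝓘(ℝ, EG) ∞ (fun g => K g 0) g₀ :=
    hKs.comp g₀ (contMDiffAt_id.prodMk contMDiffAt_const)
  have h3 := ContMDiffAt.clm_apply_of_inCoordinates hKd h1 h2
  refine h3.congr_of_eventuallyEq ?_
  filter_upwards [hK0] with g hg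
  exact TangentBundle.mk_eq_mk hg.1.symm hg.2.symm

/-- A curve in the target fibre over `m` representing the value of a smooth section at `m`. -/
lemma exists_curve {X : ∀ m, 𝒢.Fiber m} (hX : 𝒢.IsSmoothSec X) (m : M) :
    ∃ h : ℝ → G, ContMDiffAt 𝓘(ℝ, ℝ) 𝓘(ℝ, EG) ∞ h 0 ∧ h 0 = 𝒢.unit m ∧
      (∀ᶠ δ in 𝓝 (0 : ℝ), 𝒢.tgt (h δ) = m) ∧
      (mfderiv 𝓘(ℝ, ℝ) 𝓘(ℝ, EG) h 0 : ℝ →L[ℝ] EG) 1 = (𝒢.leftRep m (X m) : EG) := by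
  obtain ⟨H, hH, hHt, hH0⟩ := 𝒢.exists_curves hX m
  have hc : ContMDiffAt 𝓘(ℝ, ℝ) (𝓘(ℝ, EM).prod 𝓘(ℝ, ℝ)) ∞ (fun δ : ℝ => (m, δ)) 0 :=
    contMDiffAt_const.prodMk contMDiffAt_id
  exact ⟨fun δ => H (m, δ), hH.comp (0 : ℝ) hc, hH0.self_of_nhds.1,
    hc.continuousAt.eventually hHt, (DFunLike.congr_fun hH0.self_of_nhds.2.mfderiv (1 : ℝ)).trans
      (one_smul ℝ (𝒢.leftRep m (X m) : EG))⟩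

omit [IsManifold 𝓘(ℝ, EG) ∞ G] in
-- Chain rule along `δ ↦ g ∘ h δ`. The point `m` is kept apart from `src g` so that one curve `h`
-- can serve a whole family of arrows with the same source.
lemma vderiv_leftInv_eq_deriv (X : ∀ m, 𝒢.Fiber m) {g : G} {m : M} (hm : 𝒢.src g = m)
    {h : ℝ → G} (hd : ContMDiffAt 𝓘(ℝ, ℝ) 𝓘(ℝ, EG) ∞ h 0) (h0 : h 0 = 𝒢.unit m)
    (ht : ∀ᶠ δ in 𝓝 (0 : ℝ), 𝒢.tgt (h δ) = m)
    (hv : (mfderiv 𝓘(ℝ, ℝ) 𝓘(ℝ, EG) h 0 : ℝ →L[ℝ] EG) 1 = 𝒢.leftRep m (X m))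
    {f : G → ℝ} (hf : ContMDiff 𝓘(ℝ, EG) 𝓘(ℝ, ℝ) ∞ f) :
    vderiv (𝒢.leftInv X) f g = deriv (fun δ => f (𝒢.mul g (h δ))) 0 := by
  subst hm
  have h1 := 𝒢.hasMFDerivAt_mul_curve X g (hd.mdifferentiableAt (by simp)) h0 ht hv
  have h2 : HasMFDerivAt 𝓘(ℝ, EG) 𝓘(ℝ, ℝ) f (𝒢.mul g (h 0))
      (mfderiv 𝓘(ℝ, EG) 𝓘(ℝ, ℝ) f g : EG →L[ℝ] ℝ) := by
    rw [h0, 𝒢.mul_unit]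
    exact (hf.mdifferentiable (by simp) g).hasMFDerivAt
  let L : ℝ →L[ℝ] ℝ := (mfderiv 𝓘(ℝ, EG) 𝓘(ℝ, ℝ) f g : EG →L[ℝ] ℝ) ∘L
    (ContinuousLinearMap.toSpanSingleton ℝ (𝒢.leftInv X g : EG) : ℝ →L[ℝ] EG)
  have h3 : HasFDerivAt (fun δ => f (𝒢.mul g (h δ))) L 0 :=
    hasMFDerivAt_iff_hasFDerivAt.1 (HasMFDerivAt.comp (0 : ℝ) h2 h1)
  refine Eq.trans ?_ h3.hasDerivAt.deriv.symm
  exact (congrArg (mfderiv 𝓘(ℝ, EG) 𝓘(ℝ, ℝ) f g : EG →L[ℝ] ℝ)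
    (one_smul ℝ (𝒢.leftInv X g : EG))).symm

omit [IsManifold 𝓘(ℝ, EG) ∞ G] in
-- Left translation by a unit is the identity on its target fibre, so the translated curve is the
-- curve itself.
lemma leftInv_unit_of_curve (X : ∀ m, 𝒢.Fiber m) {m : M}
    {h : ℝ → G} (hd : ContMDiffAt 𝓘(ℝ, ℝ) 𝓘(ℝ, EG) ∞ h 0) (h0 : h 0 = 𝒢.unit m)
    (ht : ∀ᶠ δ in 𝓝 (0 : ℝ), 𝒢.tgt (h δ) = m)
    (hv : (mfderiv 𝓘(ℝ, ℝ) 𝓘(ℝ, EG) h 0 : ℝ →L[ℝ] EG) 1 = 𝒢.leftRep m (X m)) :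
    (𝒢.leftInv X (𝒢.unit m) : EG) = 𝒢.leftRep m (X m) := by
  have hs := 𝒢.src_unit m
  have h1 := 𝒢.hasMFDerivAt_mul_curve X (𝒢.unit m) (hd.mdifferentiableAt (by simp))
    (h0.trans (by rw [hs])) (by rwa [hs]) (by rwa [hs])
  have h2 : (fun δ => 𝒢.mul (𝒢.unit m) (h δ)) =ᶠ[𝓝 0] h := by
    filter_upwards [ht] with δ hδ
    rw [← hδ, 𝒢.unit_mul]
  rw [← hv]
  exact (one_smul ℝ (𝒢.leftInv X (𝒢.unit m) : EG)).symm.trans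
    (DFunLike.congr_fun (h1.congr_of_eventuallyEq h2.symm).mfderiv.symm (1 : ℝ))

lemma leftInv_unit {X : ∀ m, 𝒢.Fiber m} (hX : 𝒢.IsSmoothSec X) (m : M) :
    (𝒢.leftInv X (𝒢.unit m) : EG) = 𝒢.leftRep m (X m) := by
  obtain ⟨h, h1, h2, h3, h4⟩ := 𝒢.exists_curve hX m
  exact 𝒢.leftInv_unit_of_curve X h1 h2 h3 h4

/-- All arrows `k ε ∘ g` have the source of `g`, so the same `h` computes the inner derivative at
each of them. -/
lemma vderiv_rightInv_leftInv_eq_deriv {X : ∀ m, 𝒢.Fiber m} (hX : 𝒢.IsSmoothSec X)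
    (Z : ∀ m, 𝒢.Fiber m) (g : G) {h k : ℝ → G}
    (hd : ContMDiffAt 𝓘(ℝ, ℝ) 𝓘(ℝ, EG) ∞ h 0) (h0 : h 0 = 𝒢.unit (𝒢.src g))
    (ht : ∀ᶠ δ in 𝓝 (0 : ℝ), 𝒢.tgt (h δ) = 𝒢.src g)
    (hv : (mfderiv 𝓘(ℝ, ℝ) 𝓘(ℝ, EG) h 0 : ℝ →L[ℝ] EG) 1 = 𝒢.leftRep _ (X (𝒢.src g)))
    (kd : ContMDiffAt 𝓘(ℝ, ℝ) 𝓘(ℝ, EG) ∞ k 0) (k0 : k 0 = 𝒢.unit (𝒢.tgt g))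
    (kt : ∀ᶠ δ in 𝓝 (0 : ℝ), 𝒢.src (k δ) = 𝒢.tgt g)
    (kv : (mfderiv 𝓘(ℝ, ℝ) 𝓘(ℝ, EG) k 0 : ℝ →L[ℝ] EG) 1 = 𝒢.rightRep _ (Z (𝒢.tgt g)))
    {f : G → ℝ} (hf : ContMDiff 𝓘(ℝ, EG) 𝓘(ℝ, ℝ) ∞ f) :
    vderiv (𝒢.rightInv Z) (vderiv (𝒢.leftInv X) f) g =
      deriv (fun ε => deriv (fun δ => f (𝒢.mul (𝒢.mul (k ε) g) (h δ))) 0) 0 := by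
  refine (𝒢.op.vderiv_leftInv_eq_deriv Z rfl kd k0 kt kv
    (vderiv_contMDiff (𝒢.contMDiff_leftInv hX) hf)).trans ?_
  refine Filter.EventuallyEq.deriv_eq ?_
  filter_upwards [kt] with ε hε
  exact 𝒢.vderiv_leftInv_eq_deriv X (𝒢.src_mul _ _ hε) hd h0 ht hv hf

/-- Left- and right-invariant vector fields commute. -/
lemma vderiv_leftInv_rightInv_comm {X Z : ∀ m, 𝒢.Fiber m} (hX : 𝒢.IsSmoothSec X)
    (hZ : 𝒢.op.IsSmoothSec Z) {f : G → ℝ} (hf : ContMDiff 𝓘(ℝ, EG) 𝓘(ℝ, ℝ) ∞ f) :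
    vderiv (𝒢.leftInv X) (vderiv (𝒢.rightInv Z) f) =
      vderiv (𝒢.rightInv Z) (vderiv (𝒢.leftInv X) f) := by
  funext g
  obtain ⟨h, hd, h0, ht, hv⟩ := 𝒢.exists_curve hX (𝒢.src g)
  obtain ⟨k, kd, k0, kt, kv⟩ := 𝒢.op.exists_curve hZ (𝒢.tgt g)
  rw [𝒢.vderiv_rightInv_leftInv_eq_deriv hX Z g hd h0 ht hv kd k0 kt kv hf]
  refine (𝒢.op.vderiv_rightInv_leftInv_eq_deriv hZ X g kd k0 kt kv hd h0 ht hv hf).trans ?_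
  -- The formula for the opposite groupoid gives the other order of differentiation, with the
  -- product bracketed as `k ∘ (g ∘ h)`. Associativity and symmetry of mixed partial derivatives
  -- conclude.
  have e1 : ∀ᶠ δ in 𝓝 (0 : ℝ), (fun ε => f (𝒢.mul (k ε) (𝒢.mul g (h δ)))) =ᶠ[𝓝 0]
      fun ε => f (𝒢.mul (𝒢.mul (k ε) g) (h δ)) := by
    filter_upwards [ht] with δ hδ
    filter_upwards [kt] with ε hε
    rw [𝒢.mul_assoc _ _ _ hε hδ.symm]
  have e2 : (fun δ => deriv (fun ε => f (𝒢.mul (k ε) (𝒢.mul g (h δ)))) 0) =ᶠ[𝓝 0]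
      fun δ => deriv (fun ε => f (𝒢.mul (𝒢.mul (k ε) g) (h δ))) 0 := by
    filter_upwards [e1] with δ hδ using hδ.deriv_eq
  refine e2.deriv_eq.trans (deriv_deriv_comm (Φ := fun p =>
    f (𝒢.mul (𝒢.mul (k p.1) g) (h p.2))) ?_).symm
  have kf : ContMDiffAt 𝓘(ℝ, ℝ × ℝ) 𝓘(ℝ, EG) ∞ (fun p : ℝ × ℝ => k p.1) (0, 0) :=
    kd.comp ((0 : ℝ), (0 : ℝ)) contDiff_fst.contMDiff.contMDiffAt
  have hf2 : ContMDiffAt 𝓘(ℝ, ℝ × ℝ) 𝓘(ℝ, EG) ∞ (fun p : ℝ × ℝ => h p.2) (0, 0) :=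
    hd.comp ((0 : ℝ), (0 : ℝ)) contDiff_snd.contMDiff.contMDiffAt
  have ke : ∀ᶠ p in 𝓝 ((0 : ℝ), (0 : ℝ)), 𝒢.src (k p.1) = 𝒢.tgt g :=
    (continuous_fst.continuousAt (x := ((0 : ℝ), (0 : ℝ)))).eventually kt
  have he : ∀ᶠ p in 𝓝 ((0 : ℝ), (0 : ℝ)), 𝒢.tgt (h p.2) = 𝒢.src g :=
    (continuous_snd.continuousAt (x := ((0 : ℝ), (0 : ℝ)))).eventually ht
  refine contMDiffAt_iff_contDiffAt.1 (hf.contMDiffAt.comp _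
    (𝒢.contMDiffAt_mul (𝒢.contMDiffAt_mul kf contMDiffAt_const ke) hf2 ?_))
  filter_upwards [ke, he] with p h1 h2
  rw [𝒢.src_mul _ _ h1, h2]

omit [IsManifold 𝓘(ℝ, EG) ∞ G] in
/-- The inverse of a curve in a target fibre through a unit represents the opposite element
of `E`, in the source fibre. -/
lemma mfderiv_inv_curve (m : M) (u : 𝒢.Fiber m) {h : ℝ → G}
    (hd : ContMDiffAt 𝓘(ℝ, ℝ) 𝓘(ℝ, EG) ∞ h 0) (h0 : h 0 = 𝒢.unit m)
    (ht : ∀ᶠ δ in 𝓝 (0 : ℝ), 𝒢.tgt (h δ) = m)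
    (hv : (mfderiv 𝓘(ℝ, ℝ) 𝓘(ℝ, EG) h 0 : ℝ →L[ℝ] EG) 1 = 𝒢.leftRep m u) :
    (mfderiv 𝓘(ℝ, ℝ) 𝓘(ℝ, EG) (fun δ => 𝒢.inv (h δ)) 0 : ℝ →L[ℝ] EG) 1 =
      -(𝒢.rightRep m u : EG) := by
  -- On the axes `q` is the inverse curve and the curve itself; on the diagonal it is the curve of
  -- units over the sources. The diagonal derivative is the sum of the two axis derivatives, so the
  -- inverse curve has velocity `dUnit (dSrc l) - l`, where `l` is the left representative.
  set q : ℝ × ℝ → G := fun p => 𝒢.mul (𝒢.inv (h p.1)) (h p.2) with hq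
  have hid : ContMDiffAt 𝓘(ℝ, ℝ) 𝓘(ℝ, EG) ∞ (fun δ => 𝒢.inv (h δ)) 0 :=
    𝒢.contMDiff_inv.contMDiffAt.comp (0 : ℝ) hd
  have hqs : ContMDiffAt 𝓘(ℝ, ℝ × ℝ) 𝓘(ℝ, EG) ∞ q (0, 0) := by
    have i1 : ContMDiffAt 𝓘(ℝ, ℝ × ℝ) 𝓘(ℝ, EG) ∞ (fun p : ℝ × ℝ => 𝒢.inv (h p.1)) (0, 0) :=
      ContMDiffAt.comp (g := fun δ => 𝒢.inv (h δ)) ((0 : ℝ), (0 : ℝ)) hid contDiff_fst.contMDiff.contMDiffAt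
    have i2 : ContMDiffAt 𝓘(ℝ, ℝ × ℝ) 𝓘(ℝ, EG) ∞ (fun p : ℝ × ℝ => h p.2) (0, 0) :=
      hd.comp ((0 : ℝ), (0 : ℝ)) contDiff_snd.contMDiff.contMDiffAt
    refine 𝒢.contMDiffAt_mul i1 i2 ?_
    filter_upwards [(continuous_fst.continuousAt (x := ((0 : ℝ), (0 : ℝ)))).eventually ht,
      (continuous_snd.continuousAt (x := ((0 : ℝ), (0 : ℝ)))).eventually ht] with p h1 h2
    rw [𝒢.src_inv, h1, h2]
  set Q : ℝ × ℝ →L[ℝ] EG := mfderiv 𝓘(ℝ, ℝ × ℝ) 𝓘(ℝ, EG) q (0, 0) with hQ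
  have hqd : HasMFDerivAt 𝓘(ℝ, ℝ × ℝ) 𝓘(ℝ, EG) q (0, 0) Q :=
    (hqs.mdifferentiableAt (by simp)).hasMFDerivAt
  have hl : HasFDerivAt (fun t : ℝ => (t, (0 : ℝ))) (ContinuousLinearMap.inl ℝ ℝ ℝ) 0 :=
    (ContinuousLinearMap.inl ℝ ℝ ℝ).hasFDerivAt
  have hr : HasFDerivAt (fun t : ℝ => ((0 : ℝ), t)) (ContinuousLinearMap.inr ℝ ℝ ℝ) 0 :=
    (ContinuousLinearMap.inr ℝ ℝ ℝ).hasFDerivAt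
  have hg : HasFDerivAt (fun t : ℝ => (t, t))
      ((ContinuousLinearMap.id ℝ ℝ).prod (ContinuousLinearMap.id ℝ ℝ)) 0 :=
    (hasFDerivAt_id _).prodMk (hasFDerivAt_id _)
  have m0 : 𝒢.tgt (h 0) = m := ht.self_of_nhds
  have a1 : HasMFDerivAt 𝓘(ℝ, ℝ) 𝓘(ℝ, EG) (fun t => q (t, 0)) 0
      (Q ∘L ContinuousLinearMap.inl ℝ ℝ ℝ) :=
    HasMFDerivAt.comp (f := fun t : ℝ => (t, (0 : ℝ))) (0 : ℝ) hqd hl.hasMFDerivAt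
  have a2 : HasMFDerivAt 𝓘(ℝ, ℝ) 𝓘(ℝ, EG) (fun t => q (0, t)) 0
      (Q ∘L ContinuousLinearMap.inr ℝ ℝ ℝ) :=
    HasMFDerivAt.comp (f := fun t : ℝ => ((0 : ℝ), t)) (0 : ℝ) hqd hr.hasMFDerivAt
  have a3 : HasMFDerivAt 𝓘(ℝ, ℝ) 𝓘(ℝ, EG) (fun t => q (t, t)) 0
      (Q ∘L (ContinuousLinearMap.id ℝ ℝ).prod (ContinuousLinearMap.id ℝ ℝ)) :=
    HasMFDerivAt.comp (f := fun t : ℝ => (t, t)) (0 : ℝ) hqd hg.hasMFDerivAt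
  have b1 : (fun δ => 𝒢.inv (h δ)) =ᶠ[𝓝 0] fun t => q (t, 0) := by
    filter_upwards [ht] with t h1
    rw [hq]
    simp only
    rw [h0, ← h1, ← 𝒢.src_inv, 𝒢.mul_unit]
  have b2 : h =ᶠ[𝓝 0] fun t => q (0, t) := by
    filter_upwards [ht] with t h1
    rw [hq]
    simp only
    rw [h0, 𝒢.inv_unit, ← h1, 𝒢.unit_mul]
  have b3 : (𝒢.unit ∘ 𝒢.src ∘ h) = fun t => q (t, t) := by
    funext t
    simp only [hq, 𝒢.inv_mul, Function.comp]
  have c1 : (mfderiv 𝓘(ℝ, ℝ) 𝓘(ℝ, EG) (fun δ => 𝒢.inv (h δ)) 0 : ℝ →L[ℝ] EG) 1 = Q (1, 0) :=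
    DFunLike.congr_fun (a1.congr_of_eventuallyEq b1).mfderiv (1 : ℝ)
  have c2 : (mfderiv 𝓘(ℝ, ℝ) 𝓘(ℝ, EG) h 0 : ℝ →L[ℝ] EG) 1 = Q (0, 1) :=
    DFunLike.congr_fun (a2.congr_of_eventuallyEq b2).mfderiv (1 : ℝ)
  have c3 : (𝒢.dUnit m (𝒢.dSrc m (𝒢.leftRep m u)) : EG) = Q (1, 1) := by
    have s1 : HasMFDerivAt 𝓘(ℝ, EG) 𝓘(ℝ, EM) 𝒢.src (h 0)
        (mfderiv 𝓘(ℝ, EG) 𝓘(ℝ, EM) 𝒢.src (𝒢.unit m) : EG →L[ℝ] EM) := by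
      rw [h0]
      exact (𝒢.contMDiff_src.mdifferentiable (by simp) _).hasMFDerivAt
    have s2 : HasMFDerivAt 𝓘(ℝ, EM) 𝓘(ℝ, EG) 𝒢.unit (𝒢.src (h 0))
        (mfderiv 𝓘(ℝ, EM) 𝓘(ℝ, EG) 𝒢.unit m : EM →L[ℝ] EG) := by
      rw [h0, 𝒢.src_unit]
      exact (𝒢.contMDiff_unit.mdifferentiable (by simp) _).hasMFDerivAt
    have s3 := HasMFDerivAt.comp (0 : ℝ) s2
      (HasMFDerivAt.comp (0 : ℝ) s1 (hd.mdifferentiableAt (by simp)).hasMFDerivAt)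
    rw [b3] at s3
    refine Eq.trans ?_ (DFunLike.congr_fun (hasMFDerivAt_unique s3 a3) (1 : ℝ))
    exact congrArg (fun w : EG => (mfderiv 𝓘(ℝ, EM) 𝓘(ℝ, EG) 𝒢.unit m : EM →L[ℝ] EG)
      ((mfderiv 𝓘(ℝ, EG) 𝓘(ℝ, EM) 𝒢.src (𝒢.unit m) : EG →L[ℝ] EM) w)) hv.symm
  have c4 : Q (1, 1) = Q (1, 0) + Q (0, 1) := by
    rw [← map_add]
    simp
  have c5 : ∀ l r w : EG, r = l - w → w = Q (1, 1) → Q (0, 1) = l → Q (1, 0) = -r := by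
    rintro l r w rfl rfl h2
    rw [c4, h2]
    abel
  exact c1.trans (c5 _ _ _ (𝒢.rightRep_eq_leftRep_sub m u) c3 (c2.symm.trans hv))

end Invariant

end LieGroupoid

/-! ### Algebraic rules for derivations -/

section VectorFieldAlgebra

variable {EG : Type*} [NormedAddCommGroup EG] [NormedSpace ℝ EG]
  {G : Type*} [TopologicalSpace G] [ChartedSpace EG G]
  (V : ∀ g : G, TangentSpace 𝓘(ℝ, EG) g) {f f' : G → ℝ}

lemma vderiv_add (hf : ContMDiff 𝓘(ℝ, EG) 𝓘(ℝ, ℝ) ∞ f) (hf' : ContMDiff 𝓘(ℝ, EG) 𝓘(ℝ, ℝ) ∞ f') :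
    vderiv V (fun g => f g + f' g) = fun g => vderiv V f g + vderiv V f' g := by
  funext g
  exact DFunLike.congr_fun (((hf.mdifferentiable (by simp) g).hasMFDerivAt.add
    (hf'.mdifferentiable (by simp) g).hasMFDerivAt).mfderiv) (V g)

lemma vderiv_mul (hf : ContMDiff 𝓘(ℝ, EG) 𝓘(ℝ, ℝ) ∞ f) (hf' : ContMDiff 𝓘(ℝ, EG) 𝓘(ℝ, ℝ) ∞ f') :
    vderiv V (fun g => f g * f' g) = fun g => f g * vderiv V f' g + f' g * vderiv V f g := by
  funext g
  exact DFunLike.congr_fun (((hf.mdifferentiable (by simp) g).hasMFDerivAt.mul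
    (hf'.mdifferentiable (by simp) g).hasMFDerivAt).mfderiv) (V g)

lemma vderiv_neg (f : G → ℝ) : vderiv V (fun g => -f g) = fun g => -vderiv V f g := by
  funext g
  exact DFunLike.congr_fun (mfderiv_neg (I := 𝓘(ℝ, EG)) (f := f) (x := g)) (V g)

end VectorFieldAlgebra

/-! ### Right representatives, inversion, and the anchor at units -/

namespace LieGroupoid

section Units

variable {EG EM : Type*} [NormedAddCommGroup EG] [NormedSpace ℝ EG]
    [NormedAddCommGroup EM] [NormedSpace ℝ EM]
    {G M : Type*} [TopologicalSpace G] [ChartedSpace EG G] [IsManifold 𝓘(ℝ, EG) ∞ G]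
    [TopologicalSpace M] [ChartedSpace EM M]
    (𝒢 : LieGroupoid EG EM G M)

omit [IsManifold 𝓘(ℝ, EG) ∞ G] in
lemma vderiv_leftInv_add (X Y : ∀ m, 𝒢.Fiber m) (f : G → ℝ) :
    vderiv (𝒢.leftInv (fun m => X m + Y m)) f =
      fun g => vderiv (𝒢.leftInv X) f g + vderiv (𝒢.leftInv Y) f g := by
  funext g
  exact (congrArg (mfderiv 𝓘(ℝ, EG) 𝓘(ℝ, ℝ) f g : EG →L[ℝ] ℝ) (𝒢.leftInv_add X g Y)).trans
    (map_add (mfderiv 𝓘(ℝ, EG) 𝓘(ℝ, ℝ) f g : EG →L[ℝ] ℝ) _ _)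

omit [IsManifold 𝓘(ℝ, EG) ∞ G] in
lemma vderiv_leftInv_smul (φ : M → ℝ) (X : ∀ m, 𝒢.Fiber m) (f : G → ℝ) :
    vderiv (𝒢.leftInv (fun m => φ m • X m)) f =
      fun g => φ (𝒢.src g) * vderiv (𝒢.leftInv X) f g := by
  funext g
  exact (congrArg (mfderiv 𝓘(ℝ, EG) 𝓘(ℝ, ℝ) f g : EG →L[ℝ] ℝ) (𝒢.leftInv_smul X g φ)).trans
    (map_smul (mfderiv 𝓘(ℝ, EG) 𝓘(ℝ, ℝ) f g : EG →L[ℝ] ℝ) _ _)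

/-- Projecting a smooth section of `TG|_M` to the target fibres gives a smooth section. -/
lemma contMDiffAt_sub_dUnit_dTgt {W : ∀ m, TangentSpace 𝓘(ℝ, EG) (𝒢.unit m)} {m₀ : M}
    (hW : ContMDiffAt 𝓘(ℝ, EM) 𝓘(ℝ, EG).tangent ∞
      (fun m => (⟨𝒢.unit m, W m⟩ : TangentBundle 𝓘(ℝ, EG) G)) m₀) :
    ContMDiffAt 𝓘(ℝ, EM) 𝓘(ℝ, EG).tangent ∞
      (fun m => (⟨𝒢.unit m, W m - 𝒢.dUnit m (𝒢.dTgt m (W m))⟩ : TangentBundle 𝓘(ℝ, EG) G)) m₀ := by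
  -- The component along the units is the image of `W` under the tangent map of `unit ∘ tgt`.
  have h1 : ContMDiffAt 𝓘(ℝ, EM) 𝓘(ℝ, EG).tangent ∞
      (tangentMap 𝓘(ℝ, EG) 𝓘(ℝ, EG) (𝒢.unit ∘ 𝒢.tgt) ∘
        fun m => (⟨𝒢.unit m, W m⟩ : TangentBundle 𝓘(ℝ, EG) G)) m₀ :=
    (((𝒢.contMDiff_unit.comp 𝒢.contMDiff_tgt).contMDiff_tangentMap (m := ∞)
      (by simp)).contMDiffAt).comp m₀ hW
  have h2 : ContMDiffAt 𝓘(ℝ, EM) 𝓘(ℝ, EG).tangent ∞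
      (fun m => (⟨𝒢.unit m, 𝒢.dUnit m (𝒢.dTgt m (W m))⟩ : TangentBundle 𝓘(ℝ, EG) G)) m₀ := by
    refine h1.congr_of_eventuallyEq (Filter.Eventually.of_forall fun m => ?_)
    refine TangentBundle.mk_eq_mk (by simp [𝒢.tgt_unit]) ?_
    have s1 := (𝒢.contMDiff_tgt.mdifferentiable (by simp) (𝒢.unit m)).hasMFDerivAt
    have s2 : HasMFDerivAt 𝓘(ℝ, EM) 𝓘(ℝ, EG) 𝒢.unit (𝒢.tgt (𝒢.unit m))
        (mfderiv 𝓘(ℝ, EM) 𝓘(ℝ, EG) 𝒢.unit m : EM →L[ℝ] EG) := by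
      rw [𝒢.tgt_unit]
      exact (𝒢.contMDiff_unit.mdifferentiable (by simp) _).hasMFDerivAt
    exact (DFunLike.congr_fun (HasMFDerivAt.comp (𝒢.unit m) s2 s1).mfderiv (W m)).symm
  rw [Bundle.contMDiffAt_totalSpace] at hW h2 ⊢
  refine ⟨hW.1, (hW.2.sub h2.2).congr_of_eventuallyEq ?_⟩
  filter_upwards [𝒢.eventually_mem_baseSet m₀] with m hm
  exact ((trivializationAt EG (TangentSpace 𝓘(ℝ, EG)) (𝒢.unit m₀)).linear ℝ hm).map_sub _ _

/-- Smoothness is defined through left representatives; projecting these to the source fibres gives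
the right ones. This opens the results on left-invariant fields of `op` to right-invariant fields.
-/
lemma isSmoothSec_op {X : ∀ m, 𝒢.Fiber m} (hX : 𝒢.IsSmoothSec X) : 𝒢.op.IsSmoothSec X := by
  intro m₀
  have := 𝒢.op.contMDiffAt_sub_dUnit_dTgt (hX m₀)
  refine this.congr_of_eventuallyEq (Filter.Eventually.of_forall fun m => ?_)
  exact TangentBundle.mk_eq_mk rfl (𝒢.rightRep_eq_leftRep_sub m (X m))

/-- Inversion maps left-invariant vector fields to opposites of right-invariant ones. -/
lemma vderiv_leftInv_comp_inv {X : ∀ m, 𝒢.Fiber m} (hX : 𝒢.IsSmoothSec X)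
    {f : G → ℝ} (hf : ContMDiff 𝓘(ℝ, EG) 𝓘(ℝ, ℝ) ∞ f) :
    vderiv (𝒢.leftInv X) (f ∘ 𝒢.inv) = fun g => -vderiv (𝒢.rightInv X) f (𝒢.inv g) := by
  funext g
  obtain ⟨h, hd, h0, ht, hv⟩ := 𝒢.exists_curve hX (𝒢.src g)
  rw [𝒢.vderiv_leftInv_eq_deriv X rfl hd h0 ht hv (hf.comp 𝒢.contMDiff_inv)]
  have e1 : (fun δ => (f ∘ 𝒢.inv) (𝒢.mul g (h δ))) =ᶠ[𝓝 0]
      fun δ => f (𝒢.mul (𝒢.inv (h δ)) (𝒢.inv g)) := by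
    filter_upwards [ht] with δ hδ
    simp only [Function.comp]
    rw [𝒢.inv_mul_rev hδ.symm]
  -- The inverted curve lies in a source fibre and represents `-X` by `mfderiv_inv_curve`, hence the
  -- section with factor `-1`.
  have e2 := 𝒢.op.vderiv_leftInv_eq_deriv (fun m => (-1 : ℝ) • X m) (g := 𝒢.inv g)
    (h := fun δ => 𝒢.inv (h δ)) (𝒢.tgt_inv g) (𝒢.contMDiff_inv.contMDiffAt.comp (0 : ℝ) hd)
    (by rw [h0, 𝒢.inv_unit])
    (by
      filter_upwards [ht] with δ hδ
      exact (𝒢.src_inv _).trans hδ)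
    ((𝒢.mfderiv_inv_curve _ _ hd h0 ht hv).trans (by
      have := (𝒢.rightRep (𝒢.src g)).map_smul (-1 : ℝ) (X (𝒢.src g))
      exact (this.trans (neg_one_smul ℝ (𝒢.rightRep (𝒢.src g) (X (𝒢.src g))))).symm)) hf
  rw [e1.deriv_eq]
  refine e2.symm.trans ?_
  exact (congrFun (𝒢.op.vderiv_leftInv_smul (fun _ => -1) X f) (𝒢.inv g)).trans (neg_one_mul _)

/-- The anchor acts on restrictions to the units as `X^L - X^R`. -/
lemma anchorDeriv_comp_unit {X : ∀ m, 𝒢.Fiber m} (hX : 𝒢.IsSmoothSec X) {p : G → ℝ}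
    (hp : ContMDiff 𝓘(ℝ, EG) 𝓘(ℝ, ℝ) ∞ p) (m : M) :
    𝒢.anchorDeriv X (fun x => p (𝒢.unit x)) m =
      vderiv (𝒢.leftInv X) p (𝒢.unit m) - vderiv (𝒢.rightInv X) p (𝒢.unit m) := by
  set P : EG →L[ℝ] ℝ := mfderiv 𝓘(ℝ, EG) 𝓘(ℝ, ℝ) p (𝒢.unit m)
  have h1 := HasMFDerivAt.comp m (hp.mdifferentiable (by simp) (𝒢.unit m)).hasMFDerivAt
    (𝒢.contMDiff_unit.mdifferentiable (by simp) m).hasMFDerivAt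
  have h2 : 𝒢.anchorDeriv X (fun x => p (𝒢.unit x)) m = P (𝒢.dUnit m (𝒢.anchor m (X m))) :=
    DFunLike.congr_fun h1.mfderiv (𝒢.anchor m (X m))
  have h3 : vderiv (𝒢.leftInv X) p (𝒢.unit m) = P (𝒢.leftRep m (X m)) :=
    congrArg P (𝒢.leftInv_unit hX m)
  have h4 : vderiv (𝒢.rightInv X) p (𝒢.unit m) = P (𝒢.rightRep m (X m)) :=
    congrArg P (𝒢.op.leftInv_unit (𝒢.isSmoothSec_op hX) m)
  have h5 : ∀ l r w : EG, r = l - w → P w = P l - P r := by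
    rintro l r w rfl
    rw [map_sub]
    ring
  rw [h2, h3, h4]
  -- At a unit the two representatives differ by the image of the anchor.
  exact h5 _ _ _ (𝒢.rightRep_eq m (X m))

/-- `Ts` sends the left representative to the anchor, as `Tt` kills it. This produces the derivative
term of the Leibniz rule. -/
lemma vderiv_leftInv_comp_src {X : ∀ m, 𝒢.Fiber m} (hX : 𝒢.IsSmoothSec X) {φ : M → ℝ}
    (hφ : ContMDiff 𝓘(ℝ, EM) 𝓘(ℝ, ℝ) ∞ φ) (m : M) :
    vderiv (𝒢.leftInv X) (φ ∘ 𝒢.src) (𝒢.unit m) = 𝒢.anchorDeriv X φ m := by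
  have s2 : HasMFDerivAt 𝓘(ℝ, EM) 𝓘(ℝ, ℝ) φ (𝒢.src (𝒢.unit m))
      (mfderiv 𝓘(ℝ, EM) 𝓘(ℝ, ℝ) φ m : EM →L[ℝ] ℝ) := by
    rw [𝒢.src_unit]
    exact (hφ.mdifferentiable (by simp) _).hasMFDerivAt
  have s1 := (𝒢.contMDiff_src.mdifferentiable (by simp) (𝒢.unit m)).hasMFDerivAt
  refine (DFunLike.congr_fun (HasMFDerivAt.comp (𝒢.unit m) s2 s1).mfderiv
    (𝒢.leftInv X (𝒢.unit m))).trans ?_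
  refine congrArg (mfderiv 𝓘(ℝ, EM) 𝓘(ℝ, ℝ) φ m : EM →L[ℝ] ℝ) ?_
  exact (congrArg (𝒢.dSrc m) (𝒢.leftInv_unit hX m)).trans (𝒢.dSrc_leftRep m (X m))

end Units

end LieGroupoid

/-! ### Extension of vectors to global sections -/

namespace LieGroupoid

section Extension

variable {EG EM : Type*} [NormedAddCommGroup EG] [NormedSpace ℝ EG]
    [NormedAddCommGroup EM] [NormedSpace ℝ EM] [FiniteDimensional ℝ EM]
    {G M : Type*} [TopologicalSpace G] [ChartedSpace EG G] [IsManifold 𝓘(ℝ, EG) ∞ G]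
    [TopologicalSpace M] [ChartedSpace EM M] [IsManifold 𝓘(ℝ, EM) ∞ M] [T2Space M]
    (𝒢 : LieGroupoid EG EM G M)

/-- Every element of a fibre of `E` extends to a smooth section. -/
lemma exists_sec_eq (m₀ : M) (u : 𝒢.Fiber m₀) : ∃ Z : 𝒢.Sec, Z.1 m₀ = u := by
  set e := trivializationAt EG (TangentSpace 𝓘(ℝ, EG)) (𝒢.unit m₀) with he
  have hU : IsOpen (𝒢.unit ⁻¹' e.baseSet) := e.open_baseSet.preimage 𝒢.contMDiff_unit.continuous
  have hm₀ : 𝒢.unit m₀ ∈ e.baseSet := FiberBundle.mem_baseSet_trivializationAt' _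
  obtain ⟨ρ, -, hρ⟩ := (SmoothBumpFunction.nhds_basis_tsupport (I := 𝓘(ℝ, EM)) m₀).mem_iff.1
    (hU.mem_nhds hm₀)
  set v : EG := (e ⟨𝒢.unit m₀, 𝒢.leftRep m₀ u⟩).2 with hv
  -- A constant vector in a trivialization, cut off by a bump function and therefore zero away from
  -- its domain.
  set W : ∀ m, TangentSpace 𝓘(ℝ, EG) (𝒢.unit m) := fun m => e.symmₗ ℝ (𝒢.unit m) (ρ m • v) with hW
  have hWs : ContMDiff 𝓘(ℝ, EM) 𝓘(ℝ, EG).tangent ∞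
      (fun m => (⟨𝒢.unit m, W m⟩ : TangentBundle 𝓘(ℝ, EG) G)) := by
    intro m₁
    by_cases h1 : m₁ ∈ tsupport ρ
    · have h2 : 𝒢.unit m₁ ∈ e.baseSet := hρ h1
      have h3 : ContMDiffAt 𝓘(ℝ, EM) (𝓘(ℝ, EG).prod 𝓘(ℝ, EG)) ∞
          (fun m => (𝒢.unit m, ρ m • v)) m₁ :=
        (𝒢.contMDiff_unit m₁).prodMk (ρ.contMDiffAt.smul contMDiffAt_const)
      have h4 := ((e.contMDiffOn_symm (IB := 𝓘(ℝ, EG)) (n := ∞)).contMDiffAt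
        (e.open_target.mem_nhds (e.mem_target.2 h2 : (𝒢.unit m₁, ρ m₁ • v) ∈ e.target))).comp m₁ h3
      refine h4.congr_of_eventuallyEq ?_
      filter_upwards [hU.mem_nhds h2] with m hm
      exact (congrArg (fun w => (⟨𝒢.unit m, w⟩ : TangentBundle 𝓘(ℝ, EG) G))
        (e.symmₗ_apply hm (ρ m • v))).trans (e.mk_symm hm _)
    · have h2 : ContMDiffAt 𝓘(ℝ, EM) 𝓘(ℝ, EG).tangent ∞
          (fun m => (⟨𝒢.unit m, 0⟩ : TangentBundle 𝓘(ℝ, EG) G)) m₁ :=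
        (Bundle.contMDiff_zeroSection ℝ (TangentSpace 𝓘(ℝ, EG) : G → Type _)).contMDiffAt.comp m₁
          (𝒢.contMDiff_unit m₁)
      refine h2.congr_of_eventuallyEq ?_
      filter_upwards [(isClosed_tsupport ρ).isOpen_compl.mem_nhds h1] with m hm
      refine TangentBundle.mk_eq_mk rfl ?_
      rw [hW]
      simp only [image_eq_zero_of_notMem_tsupport hm, zero_smul]
      exact map_zero (e.symmₗ ℝ (𝒢.unit m))
  have hW0 : W m₀ = 𝒢.leftRep m₀ u := by
    simp only [hW, ρ.eq_one, one_smul, hv]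
    exact (e.symmₗ_apply hm₀ _).trans (e.symm_apply_apply_mk hm₀ _)
  refine ⟨⟨fun m => Submodule.Quotient.mk (W m), fun m₁ => ?_⟩, ?_⟩
  · exact 𝒢.contMDiffAt_sub_dUnit_dTgt (hWs m₁)
  · exact (congrArg Submodule.Quotient.mk hW0).trans (𝒢.mk_leftRep m₀ u)

end Extension

end LieGroupoid

/-! ### Second and third derivatives of a critical function at the units -/

namespace LieGroupoid

section Contrast

set_option linter.unusedSectionVars false

variable {EG EM : Type*} [NormedAddCommGroup EG] [NormedSpace ℝ EG]
    [NormedAddCommGroup EM] [NormedSpace ℝ EM] [FiniteDimensional ℝ EM]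
    {G M : Type*} [TopologicalSpace G] [ChartedSpace EG G] [IsManifold 𝓘(ℝ, EG) ∞ G]
    [TopologicalSpace M] [ChartedSpace EM M] [IsManifold 𝓘(ℝ, EM) ∞ M] [T2Space M]
    (𝒢 : LieGroupoid EG EM G M) (Φ : C^∞⟮𝓘(ℝ, EG), G; 𝓘(ℝ, ℝ), ℝ⟯)

/-- The units are critical points of `Φ`. -/
def IsCriticalOnUnits : Prop :=
  ∀ m, mfderiv 𝓘(ℝ, EG) 𝓘(ℝ, ℝ) Φ (𝒢.unit m) = 0

variable {Φ}

lemma contMDiff_vderiv_leftInv {X : ∀ m, 𝒢.Fiber m} (hX : 𝒢.IsSmoothSec X) {f : G → ℝ}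
    (hf : ContMDiff 𝓘(ℝ, EG) 𝓘(ℝ, ℝ) ∞ f) :
    ContMDiff 𝓘(ℝ, EG) 𝓘(ℝ, ℝ) ∞ (vderiv (𝒢.leftInv X) f) :=
  vderiv_contMDiff (𝒢.contMDiff_leftInv hX) hf

lemma contMDiff_vderiv_rightInv {X : ∀ m, 𝒢.Fiber m} (hX : 𝒢.IsSmoothSec X) {f : G → ℝ}
    (hf : ContMDiff 𝓘(ℝ, EG) 𝓘(ℝ, ℝ) ∞ f) :
    ContMDiff 𝓘(ℝ, EG) 𝓘(ℝ, ℝ) ∞ (vderiv (𝒢.rightInv X) f) :=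
  vderiv_contMDiff (𝒢.op.contMDiff_leftInv (𝒢.isSmoothSec_op hX)) hf

lemma rightInv_unit {X : ∀ m, 𝒢.Fiber m} (hX : 𝒢.IsSmoothSec X) (m : M) :
    (𝒢.rightInv X (𝒢.unit m) : EG) = 𝒢.rightRep m (X m) :=
  𝒢.op.leftInv_unit (𝒢.isSmoothSec_op hX) m

/-- `X^L Φ` vanishes on the units, so its derivative along them is zero. Hence the Hessian descends
to `E`, and left and right representatives become interchangeable in it. -/
lemma hessian_dUnit_leftInv (hΦ : 𝒢.IsCriticalOnUnits Φ) {X : ∀ m, 𝒢.Fiber m} (hX : 𝒢.IsSmoothSec X) (m : M)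
    (a : TangentSpace 𝓘(ℝ, EM) m) :
    hessian Φ (𝒢.unit m) (𝒢.dUnit m a) (𝒢.leftInv X (𝒢.unit m)) = 0 := by
  rw [← mfderiv_vderiv_eq_hessian Φ (𝒢.unit m) (hΦ m) (𝒢.leftInv X)
    ((𝒢.contMDiff_leftInv hX).mdifferentiable (by simp) _)]
  have h1 := HasMFDerivAt.comp m
    ((𝒢.contMDiff_vderiv_leftInv hX Φ.contMDiff).mdifferentiable (by simp)
      (𝒢.unit m)).hasMFDerivAt
    (𝒢.contMDiff_unit.mdifferentiable (by simp) m).hasMFDerivAt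
  have h2 : vderiv (𝒢.leftInv X) Φ ∘ 𝒢.unit = fun _ => (0 : ℝ) := by
    funext x
    exact DFunLike.congr_fun (hΦ x) (𝒢.leftInv X (𝒢.unit x))
  rw [h2] at h1
  exact DFunLike.congr_fun (hasMFDerivAt_unique h1 (hasMFDerivAt_const (0 : ℝ) m)) a

lemma hessian_dUnit_leftRep (hΦ : 𝒢.IsCriticalOnUnits Φ) (m : M) (a : TangentSpace 𝓘(ℝ, EM) m) (u : 𝒢.Fiber m) :
    hessian Φ (𝒢.unit m) (𝒢.dUnit m a) (𝒢.leftRep m u) = 0 := by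
  obtain ⟨Z, rfl⟩ := 𝒢.exists_sec_eq m u
  exact (congrArg (hessian Φ (𝒢.unit m) (𝒢.dUnit m a)) (𝒢.leftInv_unit Z.2 m)).symm.trans
    (𝒢.hessian_dUnit_leftInv hΦ Z.2 m a)

lemma hessian_dUnit_rightRep (hΦ : 𝒢.IsCriticalOnUnits Φ) (m : M) (a : TangentSpace 𝓘(ℝ, EM) m) (u : 𝒢.Fiber m) :
    hessian Φ (𝒢.unit m) (𝒢.dUnit m a) (𝒢.rightRep m u) = 0 :=
  𝒢.op.hessian_dUnit_leftRep hΦ m a u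

/-- At a unit, the Hessian of `Φ` evaluated on representatives of elements of `E` is `g^Φ`. -/
lemma hessian_rightRep (hΦ : 𝒢.IsCriticalOnUnits Φ) (m : M) (v : TangentSpace 𝓘(ℝ, EG) (𝒢.unit m)) (u : 𝒢.Fiber m) :
    hessian Φ (𝒢.unit m) v (𝒢.rightRep m u) = 𝒢.metric Φ m (Submodule.Quotient.mk v) u := by
  have e1 : 𝒢.leftRep m (Submodule.Quotient.mk v) = v - 𝒢.dUnit m (𝒢.dTgt m v) := rfl
  change _ = hessian Φ (𝒢.unit m) (𝒢.leftRep m (Submodule.Quotient.mk v)) (𝒢.leftRep m u)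
  have e2 : hessian Φ (𝒢.unit m) (𝒢.leftRep m (Submodule.Quotient.mk v)) (𝒢.rightRep m u) =
      hessian Φ (𝒢.unit m) v (𝒢.rightRep m u) := by
    rw [e1, map_sub, LinearMap.sub_apply, 𝒢.hessian_dUnit_rightRep hΦ, sub_zero]
  rw [← e2, 𝒢.rightRep_eq, map_sub, hessian_symm Φ _ _ (𝒢.dUnit m _),
    𝒢.hessian_dUnit_leftRep hΦ, sub_zero]

lemma vderiv_leftInv_leftInv_unit (hΦ : 𝒢.IsCriticalOnUnits Φ) {X Y : ∀ m, 𝒢.Fiber m} (hX : 𝒢.IsSmoothSec X)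
    (hY : 𝒢.IsSmoothSec Y) (m : M) :
    vderiv (𝒢.leftInv X) (vderiv (𝒢.leftInv Y) Φ) (𝒢.unit m) = 𝒢.metric Φ m (X m) (Y m) := by
  refine (mfderiv_vderiv_eq_hessian Φ (𝒢.unit m) (hΦ m) (𝒢.leftInv Y)
    ((𝒢.contMDiff_leftInv hY).mdifferentiable (by simp) _) _).trans ?_
  exact congrArg₂ (fun a b => hessian Φ (𝒢.unit m) a b) (𝒢.leftInv_unit hX m)
    (𝒢.leftInv_unit hY m)

/-- `v (Y^R Φ) = g^Φ([v], Y)` for every tangent vector `v` at a unit. -/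
lemma mfderiv_vderiv_rightInv (hΦ : 𝒢.IsCriticalOnUnits Φ) {Y : ∀ m, 𝒢.Fiber m} (hY : 𝒢.IsSmoothSec Y) (m : M)
    (v : TangentSpace 𝓘(ℝ, EG) (𝒢.unit m)) :
    mfderiv 𝓘(ℝ, EG) 𝓘(ℝ, ℝ) (vderiv (𝒢.rightInv Y) Φ) (𝒢.unit m) v =
      𝒢.metric Φ m (Submodule.Quotient.mk v) (Y m) := by
  refine (mfderiv_vderiv_eq_hessian Φ (𝒢.unit m) (hΦ m) (𝒢.rightInv Y)
    ((𝒢.op.contMDiff_leftInv (𝒢.isSmoothSec_op hY)).mdifferentiable (by simp) _) _).trans ?_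
  exact (congrArg (hessian Φ (𝒢.unit m) v) (𝒢.rightInv_unit hY m)).trans
    (𝒢.hessian_rightRep hΦ m v (Y m))

lemma vderiv_leftInv_rightInv_unit (hΦ : 𝒢.IsCriticalOnUnits Φ) {X Y : ∀ m, 𝒢.Fiber m} (hX : 𝒢.IsSmoothSec X)
    (hY : 𝒢.IsSmoothSec Y) (m : M) :
    vderiv (𝒢.leftInv X) (vderiv (𝒢.rightInv Y) Φ) (𝒢.unit m) = 𝒢.metric Φ m (X m) (Y m) := by
  refine (𝒢.mfderiv_vderiv_rightInv hΦ hY m _).trans ?_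
  exact congrArg (fun u => 𝒢.metric Φ m u (Y m))
    ((congrArg Submodule.Quotient.mk (𝒢.leftInv_unit hX m)).trans (𝒢.mk_leftRep m (X m)))

/-- `Z^R` commutes past `Y^L` and `X^L` to the outermost place, where only its value at the unit
counts. This is tensoriality in `Z`. -/
lemma triple_eq_mfderiv (X Y Z : 𝒢.Sec) (m : M) :
    𝒢.triple Φ X.1 Y.1 Z.1 m = (mfderiv 𝓘(ℝ, EG) 𝓘(ℝ, ℝ)
      (vderiv (𝒢.leftInv X.1) (vderiv (𝒢.leftInv Y.1) Φ)) (𝒢.unit m) : EG →L[ℝ] ℝ)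
        (𝒢.rightRep m (Z.1 m)) := by
  unfold triple
  have hZ := 𝒢.isSmoothSec_op Z.2
  rw [𝒢.vderiv_leftInv_rightInv_comm Y.2 hZ Φ.contMDiff,
    𝒢.vderiv_leftInv_rightInv_comm X.2 hZ (𝒢.contMDiff_vderiv_leftInv Y.2 Φ.contMDiff)]
  exact congrArg (mfderiv 𝓘(ℝ, EG) 𝓘(ℝ, ℝ)
      (vderiv (𝒢.leftInv X.1) (vderiv (𝒢.leftInv Y.1) Φ)) (𝒢.unit m) : EG →L[ℝ] ℝ)
      (𝒢.rightInv_unit Z.2 m)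

/-- The linear form `Z ↦ X^L Y^L Z^R Φ` on the fibre of `E` at `m`. -/
def tripleForm (Φ : C^∞⟮𝓘(ℝ, EG), G; 𝓘(ℝ, ℝ), ℝ⟯) (X Y : 𝒢.Sec) (m : M) : 𝒢.Fiber m →ₗ[ℝ] ℝ :=
  (mfderiv 𝓘(ℝ, EG) 𝓘(ℝ, ℝ) (vderiv (𝒢.leftInv X.1) (vderiv (𝒢.leftInv Y.1) Φ))
    (𝒢.unit m) : EG →L[ℝ] ℝ).toLinearMap ∘ₗ 𝒢.rightRep m

lemma tripleForm_apply (X Y Z : 𝒢.Sec) (m : M) :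
    𝒢.tripleForm Φ X Y m (Z.1 m) = 𝒢.triple Φ X.1 Y.1 Z.1 m :=
  (𝒢.triple_eq_mfderiv X Y Z m).symm

lemma contMDiff_triple (X Y Z : 𝒢.Sec) :
    ContMDiff 𝓘(ℝ, EM) 𝓘(ℝ, ℝ) ∞ (𝒢.triple Φ X.1 Y.1 Z.1) :=
  (𝒢.contMDiff_vderiv_leftInv X.2 (𝒢.contMDiff_vderiv_leftInv Y.2
    (𝒢.contMDiff_vderiv_rightInv Z.2 Φ.contMDiff))).comp 𝒢.contMDiff_unit

lemma contMDiff_metric (hΦ : 𝒢.IsCriticalOnUnits Φ) (X Y : 𝒢.Sec) :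
    ContMDiff 𝓘(ℝ, EM) 𝓘(ℝ, ℝ) ∞ (fun m => 𝒢.metric Φ m (X.1 m) (Y.1 m)) := by
  have := (𝒢.contMDiff_vderiv_leftInv X.2
    (𝒢.contMDiff_vderiv_leftInv Y.2 Φ.contMDiff)).comp 𝒢.contMDiff_unit
  exact this.congr fun m => (𝒢.vderiv_leftInv_leftInv_unit hΦ X.2 Y.2 m).symm

/-- Torsion-freeness. -/
lemma metric_bracket (hΦ : 𝒢.IsCriticalOnUnits Φ) [CompleteSpace EG] (X Y Z : 𝒢.Sec) (m : M) :
    𝒢.metric Φ m (𝒢.bracket X.1 Y.1 m) (Z.1 m) =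
      𝒢.triple Φ X.1 Y.1 Z.1 m - 𝒢.triple Φ Y.1 X.1 Z.1 m := by
  unfold bracket
  -- The left side is the derivative of `Z^R Φ` along `[X^L, Y^L]`, that is, a commutator of
  -- derivations.
  rw [← 𝒢.mfderiv_vderiv_rightInv hΦ Z.2 m]
  exact mfderiv_mlieBracket (𝒢.contMDiff_leftInv X.2) (𝒢.contMDiff_leftInv Y.2)
    (𝒢.contMDiff_vderiv_rightInv Z.2 Φ.contMDiff) (𝒢.unit m)

lemma starFun_starFun : 𝒢.starFun (𝒢.starFun Φ) = Φ := by
  ext g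
  exact congrArg Φ (𝒢.inv_inv g)

lemma isCriticalOnUnits_starFun (hΦ : 𝒢.IsCriticalOnUnits Φ) : 𝒢.IsCriticalOnUnits (𝒢.starFun Φ) := by
  intro m
  have s1 : HasMFDerivAt 𝓘(ℝ, EG) 𝓘(ℝ, ℝ) Φ (𝒢.inv (𝒢.unit m)) (0 : EG →L[ℝ] ℝ) := by
    rw [𝒢.inv_unit]
    have := (Φ.contMDiff.mdifferentiable (by simp) (𝒢.unit m)).hasMFDerivAt
    rwa [hΦ m] at this
  have s2 := HasMFDerivAt.comp (𝒢.unit m) s1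
    (𝒢.contMDiff_inv.mdifferentiable (by simp) (𝒢.unit m)).hasMFDerivAt
  exact s2.mfderiv.trans (ContinuousLinearMap.zero_comp _)

/-- Absorbs the sign left by a previous application of `vderiv_leftInv_comp_inv`, so that the rule
can be iterated. -/
lemma vderiv_leftInv_neg_comp_inv {X : ∀ m, 𝒢.Fiber m} (hX : 𝒢.IsSmoothSec X)
    {f : G → ℝ} (hf : ContMDiff 𝓘(ℝ, EG) 𝓘(ℝ, ℝ) ∞ f) :
    vderiv (𝒢.leftInv X) (fun g => -f (𝒢.inv g)) =
      fun g => vderiv (𝒢.rightInv X) f (𝒢.inv g) := by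
  have := 𝒢.vderiv_leftInv_comp_inv hX hf
  funext g
  rw [vderiv_neg]
  exact neg_eq_iff_eq_neg.2 (congrFun this g)

/-- Each of the three derivatives passes through the inversion with a factor `-1` and exchanges left
and right; the inversion fixes units. -/
lemma triple_starFun (X Y Z : 𝒢.Sec) (m : M) : 𝒢.triple (𝒢.starFun Φ) X.1 Y.1 Z.1 m =
    -vderiv (𝒢.rightInv X.1) (vderiv (𝒢.rightInv Y.1) (vderiv (𝒢.leftInv Z.1) Φ))
      (𝒢.unit m) := by
  have hZ := 𝒢.isSmoothSec_op Z.2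
  have e1 : vderiv (𝒢.rightInv Z.1) (𝒢.starFun Φ) =
      fun g => -vderiv (𝒢.leftInv Z.1) Φ (𝒢.inv g) :=
    𝒢.op.vderiv_leftInv_comp_inv hZ Φ.contMDiff
  unfold triple
  have h1 := 𝒢.contMDiff_vderiv_leftInv Z.2 Φ.contMDiff
  have h2 := 𝒢.contMDiff_vderiv_rightInv Y.2 h1
  rw [e1, 𝒢.vderiv_leftInv_neg_comp_inv Y.2 h1]
  refine (congrFun (𝒢.vderiv_leftInv_comp_inv X.2 h2) (𝒢.unit m)).trans ?_
  rw [𝒢.inv_unit]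

/-- Two signs cancel, leaving `X^R Y^R Φ`, which computes the same form because the Hessian descends
to `E`. -/
lemma metric_starFun (hΦ : 𝒢.IsCriticalOnUnits Φ) (m : M) : 𝒢.metric (𝒢.starFun Φ) m = 𝒢.metric Φ m := by
  refine LinearMap.ext fun u => LinearMap.ext fun v => ?_
  obtain ⟨X, rfl⟩ := 𝒢.exists_sec_eq m u
  obtain ⟨Y, rfl⟩ := 𝒢.exists_sec_eq m v
  rw [← 𝒢.vderiv_leftInv_leftInv_unit (𝒢.isCriticalOnUnits_starFun hΦ) X.2 Y.2]
  have e1 : vderiv (𝒢.leftInv Y.1) (𝒢.starFun Φ) =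
      fun g => -vderiv (𝒢.rightInv Y.1) Φ (𝒢.inv g) :=
    𝒢.vderiv_leftInv_comp_inv Y.2 Φ.contMDiff
  rw [e1, 𝒢.vderiv_leftInv_neg_comp_inv X.2 (𝒢.contMDiff_vderiv_rightInv Y.2 Φ.contMDiff)]
  simp only
  rw [𝒢.inv_unit]
  refine (𝒢.mfderiv_vderiv_rightInv hΦ Y.2 m _).trans ?_
  exact congrArg (fun u => 𝒢.metric Φ m u (Y.1 m))
    ((congrArg Submodule.Quotient.mk (𝒢.rightInv_unit X.2 m)).trans (𝒢.mk_rightRep m (X.1 m)))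

/-- Duality. -/
lemma anchorDeriv_metric (hΦ : 𝒢.IsCriticalOnUnits Φ) (X Y Z : 𝒢.Sec) (m : M) :
    𝒢.anchorDeriv X.1 (fun x => 𝒢.metric Φ x (Y.1 x) (Z.1 x)) m =
      𝒢.triple Φ X.1 Y.1 Z.1 m + 𝒢.triple (𝒢.starFun Φ) X.1 Z.1 Y.1 m := by
  have hp := 𝒢.contMDiff_vderiv_leftInv Y.2 (𝒢.contMDiff_vderiv_rightInv Z.2 Φ.contMDiff)
  have e1 : (fun x => 𝒢.metric Φ x (Y.1 x) (Z.1 x)) =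
      fun x => vderiv (𝒢.leftInv Y.1) (vderiv (𝒢.rightInv Z.1) Φ) (𝒢.unit x) :=
    funext fun x => (𝒢.vderiv_leftInv_rightInv_unit hΦ Y.2 Z.2 x).symm
  -- With the metric written as `Y^L Z^R Φ`, the anchor acts as `X^L - X^R`. The subtracted term
  -- `X^R Y^L Z^R Φ = X^R Z^R Y^L Φ` is minus the triple of the starred function.
  rw [e1, 𝒢.anchorDeriv_comp_unit X.2 hp, 𝒢.triple_starFun,
    ← 𝒢.vderiv_leftInv_rightInv_comm Y.2 (𝒢.isSmoothSec_op Z.2) Φ.contMDiff]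
  rfl

/-- The Leibniz rule. -/
lemma triple_smul_middle (hΦ : 𝒢.IsCriticalOnUnits Φ) (X Y Z : 𝒢.Sec) (φ : C^∞⟮𝓘(ℝ, EM), M; 𝓘(ℝ, ℝ), ℝ⟯) (m : M) :
    𝒢.triple Φ X.1 (fun x => φ x • Y.1 x) Z.1 m = φ m * 𝒢.triple Φ X.1 Y.1 Z.1 m +
      𝒢.anchorDeriv X.1 φ m * 𝒢.metric Φ m (Y.1 m) (Z.1 m) := by
  have hp := 𝒢.contMDiff_vderiv_leftInv Y.2 (𝒢.contMDiff_vderiv_rightInv Z.2 Φ.contMDiff)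
  unfold triple
  -- `(φY)^L = (φ ∘ src) Y^L`; the product rule then gives both terms.
  rw [𝒢.vderiv_leftInv_smul]
  refine (congrFun (vderiv_mul (𝒢.leftInv X.1)
    (φ.contMDiff.comp 𝒢.contMDiff_src) hp) (𝒢.unit m)).trans ?_
  rw [𝒢.vderiv_leftInv_comp_src X.2 φ.contMDiff, 𝒢.vderiv_leftInv_rightInv_unit hΦ Y.2 Z.2]
  simp only [Function.comp, 𝒢.src_unit]
  ring

lemma triple_add_middle (X Y Y' Z : 𝒢.Sec) (m : M) :
    𝒢.triple Φ X.1 (Y + Y').1 Z.1 m =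
      𝒢.triple Φ X.1 Y.1 Z.1 m + 𝒢.triple Φ X.1 Y'.1 Z.1 m := by
  have hp : ∀ W : 𝒢.Sec, _ := fun W =>
    𝒢.contMDiff_vderiv_leftInv W.2 (𝒢.contMDiff_vderiv_rightInv Z.2 Φ.contMDiff)
  unfold triple
  have e1 := 𝒢.vderiv_leftInv_add Y.1 Y'.1 (vderiv (𝒢.rightInv Z.1) Φ)
  refine (congrArg (fun f => vderiv (𝒢.leftInv X.1) f (𝒢.unit m)) e1).trans ?_
  exact congrFun (vderiv_add _ (hp Y) (hp Y')) (𝒢.unit m)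

end Contrast

end LieGroupoid

/-! ### Local inverses and Cramer's rule over smooth functions -/

/-- A smooth function which does not vanish at a point has a smooth inverse near this point. -/
lemma ContMDiffMap.exists_eventually_mul_eq_one {EM : Type*} [NormedAddCommGroup EM]
    [NormedSpace ℝ EM] [FiniteDimensional ℝ EM]
    {M : Type*} [TopologicalSpace M] [ChartedSpace EM M] [IsManifold 𝓘(ℝ, EM) ∞ M] [T2Space M]
    (d : C^∞⟮𝓘(ℝ, EM), M; 𝓘(ℝ, ℝ), ℝ⟯) {m₀ : M} (hd : d m₀ ≠ 0) :
    ∃ θ : C^∞⟮𝓘(ℝ, EM), M; 𝓘(ℝ, ℝ), ℝ⟯, ∀ᶠ m in 𝓝 m₀, θ m * d m = 1 := by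
  have hU : {m | d m ≠ 0} ∈ 𝓝 m₀ :=
    d.contMDiff.continuous.continuousAt.eventually (isOpen_ne.mem_nhds hd)
  obtain ⟨ρ, -, hρ⟩ := (SmoothBumpFunction.nhds_basis_tsupport (I := 𝓘(ℝ, EM)) m₀).mem_iff.1 hU
  -- The witness is `d / (d² + 1 - ρ)`: the denominator never vanishes since `ρ = 0` at the zeros of
  -- `d`, and it equals `d²` where `ρ = 1`.
  have hpos : ∀ m, d m * d m + (1 - ρ m) ≠ 0 := by
    intro m
    by_cases hm : d m = 0
    · have h1 : ρ m = 0 := by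
        by_contra h
        exact hρ (subset_tsupport _ h) hm
      simp [hm, h1]
    · have h1 := mul_self_pos.2 hm
      have h2 : ρ m ≤ 1 := ρ.le_one
      linarith
  refine ⟨⟨fun m => d m * (d m * d m + (1 - ρ m))⁻¹, ?_⟩, ?_⟩
  · exact d.contMDiff.mul (((d.contMDiff.mul d.contMDiff).add
      (contMDiff_const.sub ρ.contMDiff)).inv₀ hpos)
  · filter_upwards [ρ.eventuallyEq_one, hU] with m h1 h2
    have h2 : d m ≠ 0 := h2
    change d m * (d m * d m + (1 - ρ m))⁻¹ * d m = 1
    rw [h1]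
    simp only [Pi.one_apply, sub_self, add_zero]
    field_simp

/-- Cramer's rule without division. With `R` the smooth functions and `φ` evaluation at a point, the
coefficients are smooth by construction. -/
lemma RingHom.sum_map_vecMul_adjugate {R S : Type*} [CommRing R] [CommRing S] (φ : R →+* S)
    {k : ℕ} (A : Matrix (Fin k) (Fin k) R) (b : Fin k → R) (j : Fin k) :
    ∑ i, φ (Matrix.vecMul b A.adjugate i) * φ (A i j) = φ A.det * φ (b j) := by
  have h1 : Matrix.vecMul (Matrix.vecMul b A.adjugate) A = A.det • b := by
    rw [Matrix.vecMul_vecMul, Matrix.adjugate_mul, Matrix.vecMul_smul, Matrix.vecMul_one]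
  have h2 := congrArg φ (congrFun h1 j)
  rw [Matrix.vecMul, dotProduct, map_sum] at h2
  simpa only [map_mul, Pi.smul_apply, smul_eq_mul] using h2

/-! ### Lifts and frames of `L^F`, and smooth representation of linear forms -/

namespace LieGroupoid

section Riesz

set_option linter.unusedSectionVars false

variable {EG EM : Type*} [NormedAddCommGroup EG] [NormedSpace ℝ EG]
    [NormedAddCommGroup EM] [NormedSpace ℝ EM] [FiniteDimensional ℝ EM]
    {G M : Type*} [TopologicalSpace G] [ChartedSpace EG G] [IsManifold 𝓘(ℝ, EG) ∞ G]
    [TopologicalSpace M] [ChartedSpace EM M] [IsManifold 𝓘(ℝ, EM) ∞ M] [T2Space M]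
    (𝒢 : LieGroupoid EG EM G M) {F : C^∞⟮𝓘(ℝ, EG), G; 𝓘(ℝ, ℝ), ℝ⟯}

lemma isSmoothSec_of_eventually {Y : ∀ m, 𝒢.Fiber m}
    (hY : ∀ m₀, ∃ Z : 𝒢.Sec, ∀ᶠ m in 𝓝 m₀, Y m = Z.1 m) : 𝒢.IsSmoothSec Y := by
  intro m₀
  obtain ⟨Z, hZ⟩ := hY m₀
  refine (Z.2 m₀).congr_of_eventuallyEq ?_
  filter_upwards [hZ] with m hm
  rw [hm]

lemma sec_sum_apply {ι : Type*} (s : Finset ι) (Y : ι → 𝒢.Sec) (m : M) :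
    (∑ i ∈ s, Y i).1 m = ∑ i ∈ s, (Y i).1 m := by
  have h : (∑ i ∈ s, Y i).1 = ∑ i ∈ s, (Y i).1 := Submodule.coe_sum _ _ _
  rw [h, Finset.sum_apply]

/-- Every smooth section of `L^F` is the class of a smooth section of `E`. -/
lemma bar_surjective [SecondCountableTopology M] : Function.Surjective (𝒢.bar F) := by
  intro σ
  have : LocallyCompactSpace M := Manifold.locallyCompact_of_finiteDimensional 𝓘(ℝ, EM)
  choose Y hY using σ.2
  choose U hU hUo hUm using fun m => eventually_nhds_iff.1 (hY m)
  -- Local lifts are glued by a partition of unity. Where `ρ i` is nonzero, `Y i` lifts `σ`, so the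
  -- class of the sum is `σ` with weights adding to one.
  obtain ⟨ρ, hρ⟩ := SmoothPartitionOfUnity.exists_isSubordinate 𝓘(ℝ, EM)
    (isClosed_univ (X := M)) U hUo (fun m _ => Set.mem_iUnion.2 ⟨m, hUm m⟩)
  have key : ∀ m₀, ∃ s : Finset M, ∀ᶠ m in 𝓝 m₀,
      Function.support (fun i => ρ i m) ⊆ s := by
    intro m₀
    refine ⟨ρ.fintsupport m₀, ?_⟩
    filter_upwards [ρ.eventually_finsupport_subset m₀] with m hm i hi
    exact hm ((ρ.mem_finsupport m).2 hi)
  have hsum : ∀ (s : Finset M) (m : M), Function.support (fun i => ρ i m) ⊆ s →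
      ∑ᶠ i, ρ i m • (Y i).1 m = ∑ i ∈ s, ρ i m • (Y i).1 m := by
    intro s m hs
    refine finsum_eq_sum_of_support_subset _ fun i hi => hs fun h => hi ?_
    simp only [h, zero_smul]
  refine ⟨⟨fun m => ∑ᶠ i, ρ i m • (Y i).1 m, 𝒢.isSmoothSec_of_eventually fun m₀ => ?_⟩, ?_⟩
  · obtain ⟨s, hs⟩ := key m₀
    refine ⟨∑ i ∈ s, ρ i • Y i, ?_⟩
    filter_upwards [hs] with m hm
    rw [hsum s m hm, 𝒢.sec_sum_apply]
    rfl
  · refine Subtype.ext (funext fun m => ?_)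
    obtain ⟨s, hs⟩ := key m
    have hm := hs.self_of_nhds
    change Submodule.Quotient.mk (∑ᶠ i, ρ i m • (Y i).1 m) = σ.1 m
    rw [hsum s m hm]
    have h1 : (Submodule.Quotient.mk (∑ i ∈ s, ρ i m • (Y i).1 m) : 𝒢.QFiber F m) =
        ∑ i ∈ s, ρ i m • σ.1 m := by
      refine (map_sum (𝒢.kernel F m).mkQ _ _).trans (Finset.sum_congr rfl fun i _ => ?_)
      rw [map_smul]
      by_cases h : ρ i m = 0
      · rw [h, zero_smul, zero_smul]
      · rw [hU i m (hρ i (subset_tsupport _ h))]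
        rfl
    have h2 : ∑ i ∈ s, ρ i m = 1 := by
      rw [← finsum_eq_sum_of_support_subset _ hm]
      exact ρ.sum_eq_one (Set.mem_univ m)
    rw [h1, ← Finset.sum_smul, h2, one_smul]

/-- `g^{[F]}` is nondegenerate. -/
lemma qMetric_ext {m : M} {v w : 𝒢.QFiber F m}
    (h : ∀ u : 𝒢.Fiber m, 𝒢.qMetric F m v (Submodule.Quotient.mk u) =
      𝒢.qMetric F m w (Submodule.Quotient.mk u)) : v = w := by
  obtain ⟨v, rfl⟩ := Submodule.Quotient.mk_surjective _ v
  obtain ⟨w, rfl⟩ := Submodule.Quotient.mk_surjective _ w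
  rw [Submodule.Quotient.eq]
  refine LinearMap.mem_ker.2 (LinearMap.ext fun u => ?_)
  have := h u
  rw [qMetric_mk, qMetric_mk] at this
  rw [map_sub, LinearMap.sub_apply, this, sub_self, LinearMap.zero_apply]

lemma finrank_fiber [FiniteDimensional ℝ EG] (m : M) : Module.finrank ℝ (𝒢.Fiber m) =
    Module.finrank ℝ EG - Module.finrank ℝ EM := by
  have h1 : Function.Injective (𝒢.dUnit m) :=
    Function.LeftInverse.injective (g := 𝒢.dTgt m) (𝒢.dTgt_dUnit m)
  have h2 : Module.finrank ℝ (LinearMap.range (𝒢.dUnit m)) = Module.finrank ℝ EM :=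
    LinearMap.finrank_range_of_inj h1
  have : FiniteDimensional ℝ (TangentSpace 𝓘(ℝ, EG) (𝒢.unit m)) :=
    inferInstanceAs (FiniteDimensional ℝ EG)
  have h3 := Submodule.finrank_quotient_add_finrank (LinearMap.range (𝒢.dUnit m))
  have h4 : Module.finrank ℝ (TangentSpace 𝓘(ℝ, EG) (𝒢.unit m)) = Module.finrank ℝ EG := rfl
  rw [h2, h4] at h3
  exact Nat.eq_sub_of_add_eq h3

instance finiteDimensional_fiber [FiniteDimensional ℝ EG] (m : M) :
    FiniteDimensional ℝ (𝒢.Fiber m) := by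
  have : FiniteDimensional ℝ (TangentSpace 𝓘(ℝ, EG) (𝒢.unit m)) :=
    inferInstanceAs (FiniteDimensional ℝ EG)
  infer_instance

lemma finrank_qFiber [FiniteDimensional ℝ EG] {r : ℕ}
    (hr : ∀ m, Module.finrank ℝ (𝒢.kernel F m) = r) (m : M) :
    Module.finrank ℝ (𝒢.QFiber F m) = Module.finrank ℝ EG - Module.finrank ℝ EM - r := by
  have h := Submodule.finrank_quotient_add_finrank (𝒢.kernel F m)
  rw [hr, 𝒢.finrank_fiber] at h
  exact Nat.eq_sub_of_add_eq h

/-- The Gram matrix of a family of sections of `E`. -/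
def gram (hF : 𝒢.IsCriticalOnUnits F) {k : ℕ} (e : Fin k → 𝒢.Sec) :
    Matrix (Fin k) (Fin k) C^∞⟮𝓘(ℝ, EM), M; 𝓘(ℝ, ℝ), ℝ⟯ :=
  Matrix.of fun i j => ⟨fun m => 𝒢.metric F m ((e i).1 m) ((e j).1 m),
    𝒢.contMDiff_metric hF (e i) (e j)⟩

lemma det_gram_apply (hF : 𝒢.IsCriticalOnUnits F) {k : ℕ} (e : Fin k → 𝒢.Sec) (m : M) :
    (𝒢.gram hF e).det m =
      (Matrix.of fun i j => 𝒢.metric F m ((e i).1 m) ((e j).1 m)).det :=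
  RingHom.map_det (ContMDiffMap.evalRingHom m) (𝒢.gram hF e)

/-- Pairing a linear relation with each `v j` puts its coefficients in the left kernel of the Gram
matrix. -/
lemma linearIndependent_of_det_gram {k : ℕ} {m : M} {v : Fin k → 𝒢.Fiber m}
    (h : (Matrix.of fun i j => 𝒢.metric F m (v i) (v j)).det ≠ 0) :
    LinearIndependent ℝ (fun i => (Submodule.Quotient.mk (v i) : 𝒢.QFiber F m)) := by
  rw [Fintype.linearIndependent_iff]
  intro c hc
  refine congrFun (Matrix.eq_zero_of_vecMul_eq_zero h (funext fun j => ?_))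
  have h1 := congrArg (fun w => 𝒢.qMetric F m w (Submodule.Quotient.mk (v j))) hc
  simpa [Matrix.vecMul, dotProduct, map_sum] using h1

/-- A left kernel vector of the Gram matrix gives a combination orthogonal to a spanning family,
which is zero by nondegeneracy. -/
lemma det_gram_ne_zero {k : ℕ} {m : M} {v : Fin k → 𝒢.Fiber m}
    (hli : LinearIndependent ℝ (fun i => (Submodule.Quotient.mk (v i) : 𝒢.QFiber F m)))
    (hsp : Submodule.span ℝ (Set.range fun i => (Submodule.Quotient.mk (v i) : 𝒢.QFiber F m)) = ⊤) :
    (Matrix.of fun i j => 𝒢.metric F m (v i) (v j)).det ≠ 0 := by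
  intro h0
  obtain ⟨c, hc, hc0⟩ := Matrix.exists_vecMul_eq_zero_iff.2 h0
  refine hc (funext (Fintype.linearIndependent_iff.1 hli c (𝒢.qMetric_ext fun u => ?_)))
  rw [map_zero, LinearMap.zero_apply]
  have h1 : 𝒢.qMetric F m (∑ i, c i • (Submodule.Quotient.mk (v i) : 𝒢.QFiber F m)) = 0 := by
    refine LinearMap.ext_on_range hsp fun j => ?_
    have := congrFun hc0 j
    simpa [Matrix.vecMul, dotProduct, map_sum] using this
  rw [h1, LinearMap.zero_apply]

/-- Near every point there are sections of `E` whose classes form a frame of `L^F`. -/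
lemma exists_frame [FiniteDimensional ℝ EG] (hF : 𝒢.IsCriticalOnUnits F) {r : ℕ}
    (hr : ∀ m, Module.finrank ℝ (𝒢.kernel F m) = r) (m₀ : M) :
    ∃ (k : ℕ) (e : Fin k → 𝒢.Sec), (𝒢.gram hF e).det m₀ ≠ 0 ∧
      ∀ m, (𝒢.gram hF e).det m ≠ 0 → Submodule.span ℝ
        (Set.range fun i => (Submodule.Quotient.mk ((e i).1 m) : 𝒢.QFiber F m)) = ⊤ := by
  set b := Module.finBasis ℝ (𝒢.QFiber F m₀) with hb
  choose v hv using fun i => Submodule.Quotient.mk_surjective _ (b i)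
  choose e he using fun i => 𝒢.exists_sec_eq m₀ (v i)
  have hbe : (fun i => (Submodule.Quotient.mk ((e i).1 m₀) : 𝒢.QFiber F m₀)) = b :=
    funext fun i => by rw [he, hv]
  refine ⟨_, e, ?_, fun m hm => ?_⟩
  · rw [det_gram_apply]
    refine 𝒢.det_gram_ne_zero ?_ ?_
    · rw [hbe]; exact b.linearIndependent
    · rw [hbe]; exact b.span_eq
  · rw [det_gram_apply] at hm
    -- Constant rank enters here: the number of sections, fixed at `m₀`, is the dimension of `L^F`
    -- at `m` too.
    refine (𝒢.linearIndependent_of_det_gram hm).span_eq_top_of_card_eq_finrank' ?_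
    rw [Fintype.card_fin, 𝒢.finrank_qFiber hr, 𝒢.finrank_qFiber hr]

/-- A smooth family of linear forms on `E` which vanish on the kernel of `g^F` is locally
represented by a smooth section. -/
lemma exists_metric_eq [FiniteDimensional ℝ EG] (hF : 𝒢.IsCriticalOnUnits F) {r : ℕ}
    (hr : ∀ m, Module.finrank ℝ (𝒢.kernel F m) = r)
    (β : ∀ m, 𝒢.Fiber m →ₗ[ℝ] ℝ)
    (hβ : ∀ Z : 𝒢.Sec, ContMDiff 𝓘(ℝ, EM) 𝓘(ℝ, ℝ) ∞ fun m => β m (Z.1 m))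
    (hβ0 : ∀ m, ∀ z ∈ 𝒢.kernel F m, β m z = 0) (m₀ : M) :
    ∃ Y : 𝒢.Sec, (∀ᶠ m in 𝓝 m₀, 𝒢.metric F m (Y.1 m) = β m) ∧ (β m₀ = 0 → Y.1 m₀ = 0) := by
  obtain ⟨k, e, hdet, hspan⟩ := 𝒢.exists_frame hF hr m₀
  set A := 𝒢.gram hF e with hA
  obtain ⟨θ, hθ⟩ := ContMDiffMap.exists_eventually_mul_eq_one A.det hdet
  set b : Fin k → C^∞⟮𝓘(ℝ, EM), M; 𝓘(ℝ, ℝ), ℝ⟯ :=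
    fun j => ⟨fun m => β m ((e j).1 m), hβ (e j)⟩ with hb
  -- By Cramer's rule the coefficients of the representing section are `c / det A`, with `θ` as a
  -- global smooth substitute for `1 / det A` near `m₀`.
  set c : Fin k → C^∞⟮𝓘(ℝ, EM), M; 𝓘(ℝ, ℝ), ℝ⟯ := Matrix.vecMul b A.adjugate with hc
  have hcA : ∀ j m, ∑ i, c i m * A i j m = A.det m * b j m :=
    fun j m => RingHom.sum_map_vecMul_adjugate (ContMDiffMap.evalRingHom m) A b j
  have hYm : ∀ m, (∑ i, (θ * c i) • e i).1 m = ∑ i, (θ m * c i m) • (e i).1 m := by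
    intro m
    rw [𝒢.sec_sum_apply]
    rfl
  refine ⟨∑ i, (θ * c i) • e i, ?_, fun h0 => ?_⟩
  · filter_upwards [hθ] with m hm
    have h_smul : ∀ (x y : ℝ) (u v : 𝒢.Fiber m),
        𝒢.metric F m ((x * y) • u) v = x * (y * 𝒢.metric F m u v) := by
      intro x y u v
      rw [map_smul, LinearMap.smul_apply, smul_eq_mul, _root_.mul_assoc]
    have h_cancel : ∀ x y z : ℝ, x * y = 1 → z = x * (y * z) := by
      intro x y z h
      rw [← _root_.mul_assoc, h, one_mul]
    have hdm : A.det m ≠ 0 := right_ne_zero_of_mul_eq_one hm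
    -- Both forms descend to `L^F`, so they need only be compared on the frame.
    have key : (𝒢.kernel F m).liftQ (β m) (fun z hz => LinearMap.mem_ker.2 (hβ0 m z hz)) =
        𝒢.qMetric F m (Submodule.Quotient.mk ((∑ i, (θ * c i) • e i).1 m)) := by
      refine LinearMap.ext_on_range (hspan m hdm) fun j => ?_
      rw [qMetric_mk, hYm, map_sum, LinearMap.sum_apply]
      change b j m = _
      have h1 : ∀ i, 𝒢.metric F m ((θ m * c i m) • (e i).1 m) ((e j).1 m) =
          θ m * (c i m * A i j m) := fun i => h_smul _ _ _ _
      rw [Finset.sum_congr rfl fun i _ => h1 i, ← Finset.mul_sum, hcA]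
      exact h_cancel _ _ _ hm
    refine LinearMap.ext fun u => ?_
    exact (DFunLike.congr_fun key (Submodule.Quotient.mk u)).symm
  · rw [hYm]
    refine Finset.sum_eq_zero fun i _ => ?_
    have h1 : c i m₀ = 0 := by
      have h2 : c i m₀ = ∑ j, b j m₀ * A.adjugate j i m₀ := by
        refine (congrArg (ContMDiffMap.evalRingHom m₀) (?_ : c i = ∑ j, b j * A.adjugate j i)).trans ?_
        · rfl
        · rw [map_sum]
          exact Finset.sum_congr rfl fun j _ => map_mul _ _ _
      rw [h2]
      refine Finset.sum_eq_zero fun j _ => ?_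
      have h3 : b j m₀ = 0 := by
        change β m₀ ((e j).1 m₀) = 0
        rw [h0, LinearMap.zero_apply]
      rw [h3, zero_mul]
    rw [h1, mul_zero, zero_smul]

/-- Every element of the kernel of `g^F` extends to a smooth section of the kernel. -/
lemma exists_kernel_sec_eq [FiniteDimensional ℝ EG] (hF : 𝒢.IsCriticalOnUnits F) {r : ℕ}
    (hr : ∀ m, Module.finrank ℝ (𝒢.kernel F m) = r) {m₀ : M} {z : 𝒢.Fiber m₀}
    (hz : z ∈ 𝒢.kernel F m₀) :
    ∃ Z : 𝒢.Sec, (∀ m, Z.1 m ∈ 𝒢.kernel F m) ∧ Z.1 m₀ = z := by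
  obtain ⟨Z, rfl⟩ := 𝒢.exists_sec_eq m₀ z
  -- Near `m₀`, `Y` and `Z` induce the same form, so `Z - Y` lies in the kernel; its value at `m₀`
  -- is still `z` because the form, and hence `Y`, vanishes there. A bump function makes it global.
  obtain ⟨Y, hY, hY0⟩ := 𝒢.exists_metric_eq hF hr (fun m => 𝒢.metric F m (Z.1 m))
    (fun W => 𝒢.contMDiff_metric hF Z W) (fun m w hw => by
      rw [𝒢.metric_symm, LinearMap.mem_ker.1 hw, LinearMap.zero_apply]) m₀
  obtain ⟨ρ, -, hρ⟩ := (SmoothBumpFunction.nhds_basis_tsupport (I := 𝓘(ℝ, EM)) m₀).mem_iff.1 hY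
  let χ : C^∞⟮𝓘(ℝ, EM), M; 𝓘(ℝ, ℝ), ℝ⟯ := ⟨ρ, ρ.contMDiff⟩
  refine ⟨χ • (Z - Y), fun m => ?_, ?_⟩
  · change ρ m • (Z.1 m - Y.1 m) ∈ 𝒢.kernel F m
    by_cases h : ρ m = 0
    · rw [h, zero_smul]
      exact zero_mem _
    · refine Submodule.smul_mem _ _ (LinearMap.mem_ker.2 ?_)
      rw [map_sub, sub_eq_zero]
      exact (hρ (subset_tsupport _ h)).symm
  · change ρ m₀ • (Z.1 m₀ - Y.1 m₀) = Z.1 m₀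
    rw [ρ.eq_one, one_smul, hY0 (LinearMap.mem_ker.1 hz), sub_zero]

end Riesz

end LieGroupoid

/-! ### Construction and properties of the connections -/

namespace LieGroupoid

section Connection

set_option linter.unusedSectionVars false

variable {EG EM : Type*} [NormedAddCommGroup EG] [NormedSpace ℝ EG] [FiniteDimensional ℝ EG]
    [NormedAddCommGroup EM] [NormedSpace ℝ EM] [FiniteDimensional ℝ EM]
    {G M : Type*} [TopologicalSpace G] [ChartedSpace EG G] [IsManifold 𝓘(ℝ, EG) ∞ G]
    [TopologicalSpace M] [ChartedSpace EM M] [IsManifold 𝓘(ℝ, EM) ∞ M] [T2Space M]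
    [SecondCountableTopology M]
    (𝒢 : LieGroupoid EG EM G M) {F Φ : C^∞⟮𝓘(ℝ, EG), G; 𝓘(ℝ, ℝ), ℝ⟯}

/-- The properties of `F` and `F^*` from which a connection on `L^F` is constructed: `Φ` is
critical on `M`, induces the metric of `F`, and satisfies the Koszul conditions for the kernel of
`g^F`, which has constant rank. -/
structure IsKoszulPotential (F Φ : C^∞⟮𝓘(ℝ, EG), G; 𝓘(ℝ, ℝ), ℝ⟯) : Prop where
  critical_base : 𝒢.IsCriticalOnUnits F
  critical : 𝒢.IsCriticalOnUnits Φ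
  metric_eq : ∀ m, 𝒢.metric Φ m = 𝒢.metric F m
  regular : ∃ r : ℕ, ∀ m, Module.finrank ℝ (𝒢.kernel F m) = r
  koszul : ∀ X Y Z : 𝒢.Sec, (∀ m, Z.1 m ∈ 𝒢.kernel F m) →
    ∀ m, 𝒢.triple Φ X.1 Y.1 Z.1 m = 0
  koszul_star : ∀ X Y Z : 𝒢.Sec, (∀ m, Z.1 m ∈ 𝒢.kernel F m) →
    ∀ m, 𝒢.triple (𝒢.starFun Φ) X.1 Y.1 Z.1 m = 0

variable {𝒢}

lemma IsKoszulContrast.isKoszulPotential (hF : 𝒢.IsKoszulContrast F) :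
    𝒢.IsKoszulPotential F F where
  critical_base := hF.critical
  critical := hF.critical
  metric_eq _ := rfl
  regular := hF.regular
  koszul := hF.koszul
  koszul_star := hF.koszul_star

/-- Inversion preserves the metric and, being an involution, exchanges the two Koszul conditions. -/
lemma IsKoszulContrast.isKoszulPotential_starFun (hF : 𝒢.IsKoszulContrast F) :
    𝒢.IsKoszulPotential F (𝒢.starFun F) where
  critical_base := hF.critical
  critical := 𝒢.isCriticalOnUnits_starFun hF.critical
  metric_eq := 𝒢.metric_starFun hF.critical
  regular := hF.regular
  koszul := hF.koszul_star
  koszul_star := by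
    rw [𝒢.starFun_starFun]
    exact hF.koszul

/-- Two sections of `L^F` agree at `m` if their products with all sections of `E` do. -/
lemma qMetric_ext_sec {m : M} {v w : 𝒢.QFiber F m}
    (h : ∀ Z : 𝒢.Sec, 𝒢.qMetric F m v (Submodule.Quotient.mk (Z.1 m)) =
      𝒢.qMetric F m w (Submodule.Quotient.mk (Z.1 m))) : v = w := by
  refine 𝒢.qMetric_ext fun u => ?_
  obtain ⟨Z, rfl⟩ := 𝒢.exists_sec_eq m u
  exact h Z

lemma qMetric_symm (m : M) (v w : 𝒢.QFiber F m) :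
    𝒢.qMetric F m v w = 𝒢.qMetric F m w v := by
  obtain ⟨v, rfl⟩ := Submodule.Quotient.mk_surjective _ v
  obtain ⟨w, rfl⟩ := Submodule.Quotient.mk_surjective _ w
  exact 𝒢.metric_symm F m v w

namespace IsKoszulPotential

/-- The Koszul condition speaks of sections of the kernel; constant rank lets a single kernel vector
extend to one. -/
lemma tripleForm_kernel (h : 𝒢.IsKoszulPotential F Φ) (X Y : 𝒢.Sec) (m : M) {z : 𝒢.Fiber m}
    (hz : z ∈ 𝒢.kernel F m) : 𝒢.tripleForm Φ X Y m z = 0 := by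
  obtain ⟨r, hr⟩ := h.regular
  obtain ⟨Z, hZ, rfl⟩ := 𝒢.exists_kernel_sec_eq h.critical_base hr hz
  rw [𝒢.tripleForm_apply]
  exact h.koszul X Y Z hZ m

lemma exists_qSec (h : 𝒢.IsKoszulPotential F Φ) (X Y : 𝒢.Sec) :
    ∃ τ : 𝒢.QSec F, ∀ (Z : 𝒢.Sec) (m : M),
      𝒢.qMetric F m (τ.1 m) (Submodule.Quotient.mk (Z.1 m)) = 𝒢.triple Φ X.1 Y.1 Z.1 m := by
  obtain ⟨r, hr⟩ := h.regular
  choose W hW _ using 𝒢.exists_metric_eq h.critical_base hr (𝒢.tripleForm Φ X Y)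
    (fun Z => (𝒢.contMDiff_triple X Y Z).congr fun m => 𝒢.tripleForm_apply X Y Z m)
    (fun m z hz => h.tripleForm_kernel X Y m hz)
  -- The local solutions `W m₀` depend on the point, but near `m₀` their classes agree with the
  -- pointwise choice by nondegeneracy, so they are smooth lifts of it.
  refine ⟨⟨fun m => Submodule.Quotient.mk ((W m).1 m), fun m₀ => ⟨W m₀, ?_⟩⟩, fun Z m => ?_⟩
  · filter_upwards [hW m₀] with m hm
    refine 𝒢.qMetric_ext fun u => ?_
    rw [qMetric_mk, qMetric_mk, hm, (hW m).self_of_nhds]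
  · refine (DFunLike.congr_fun (hW m).self_of_nhds (Z.1 m)).trans ?_
    exact 𝒢.tripleForm_apply X Y Z m

/-- `X^L Y^L Z^R Φ` only depends on the class of `Y`. -/
lemma triple_congr_middle (h : 𝒢.IsKoszulPotential F Φ) (X Z : 𝒢.Sec) {Y Y' : 𝒢.Sec}
    (hY : 𝒢.bar F Y = 𝒢.bar F Y') (m : M) :
    𝒢.triple Φ X.1 Y.1 Z.1 m = 𝒢.triple Φ X.1 Y'.1 Z.1 m := by
  have hN : ∀ x, (Y - Y').1 x ∈ 𝒢.kernel F x := fun x =>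
    (Submodule.Quotient.eq _).1 (congrFun (congrArg Subtype.val hY) x)
  have h1 := 𝒢.triple_add_middle (Φ := Φ) X (Y - Y') Y' Z m
  -- Duality for the kernel section `Y - Y'`: the metric term is zero and `koszul_star` kills the
  -- starred triple, so the remaining triple vanishes.
  have h2 := 𝒢.anchorDeriv_metric h.critical X (Y - Y') Z m
  have h3 : (fun x => 𝒢.metric Φ x ((Y - Y').1 x) (Z.1 x)) = fun _ => 0 := by
    funext x
    rw [h.metric_eq, LinearMap.mem_ker.1 (hN x), LinearMap.zero_apply]
  have h4 : 𝒢.anchorDeriv X.1 (fun _ => (0 : ℝ)) m = 0 :=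
    DFunLike.congr_fun (mfderiv_const (I := 𝓘(ℝ, EM)) (I' := 𝓘(ℝ, ℝ)) (c := (0 : ℝ)) (x := m)) _
  rw [h3, h4, h.koszul_star X Z _ hN, add_zero] at h2
  rwa [sub_add_cancel, ← h2, zero_add] at h1

/-- Defined through an arbitrary choice of lifts, which `triple_congr_middle` renders immaterial. -/
lemma exists_isInducedBy (h : 𝒢.IsKoszulPotential F Φ) :
    ∃ D : 𝒢.Sec → 𝒢.QSec F → 𝒢.QSec F, 𝒢.IsInducedBy F Φ D := by
  choose τ hτ using h.exists_qSec
  choose l hl using 𝒢.bar_surjective (F := F)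
  refine ⟨fun X σ => τ X (l σ), fun X Y Z m => ?_⟩
  exact (hτ _ _ _ _).trans (h.triple_congr_middle X Z (hl _) m)

end IsKoszulPotential

namespace IsInducedBy

variable {D : 𝒢.Sec → 𝒢.QSec F → 𝒢.QSec F}

lemma eq {D' : 𝒢.Sec → 𝒢.QSec F → 𝒢.QSec F} (hD : 𝒢.IsInducedBy F Φ D)
    (hD' : 𝒢.IsInducedBy F Φ D') : D = D' := by
  funext X σ
  obtain ⟨Y, rfl⟩ := 𝒢.bar_surjective σ
  refine Subtype.ext (funext fun m => qMetric_ext_sec fun Z => ?_)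
  exact (hD X Y Z m).trans (hD' X Y Z m).symm

lemma qMetric_mk (hD : 𝒢.IsInducedBy F Φ D) (X Y Z : 𝒢.Sec) (m : M) :
    𝒢.qMetric F m ((D X (𝒢.bar F Y)).1 m) (Submodule.Quotient.mk (Z.1 m)) =
      𝒢.triple Φ X.1 Y.1 Z.1 m := hD X Y Z m

/-- `X^L` is the outermost derivative, so its coefficient `f ∘ src` is never differentiated. Real
and functional scalars are covered together. -/
lemma apply_smul_left (hD : 𝒢.IsInducedBy F Φ D) (f : M → ℝ) (X X' : 𝒢.Sec)
    (hX : ∀ m, X'.1 m = f m • X.1 m) (σ : 𝒢.QSec F) (m : M) :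
    (D X' σ).1 m = f m • (D X σ).1 m := by
  obtain ⟨Y, rfl⟩ := 𝒢.bar_surjective σ
  refine qMetric_ext_sec fun Z => ?_
  rw [map_smul, LinearMap.smul_apply, hD.qMetric_mk, hD.qMetric_mk, (funext hX : X'.1 = _)]
  unfold triple
  rw [𝒢.vderiv_leftInv_smul]
  simp only [𝒢.src_unit, smul_eq_mul]

lemma leibniz (hD : 𝒢.IsInducedBy F Φ D) (h : 𝒢.IsKoszulPotential F Φ)
    (f : C^∞⟮𝓘(ℝ, EM), M; 𝓘(ℝ, ℝ), ℝ⟯) (X : 𝒢.Sec) (σ : 𝒢.QSec F) (m : M) :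
    (D X (f • σ)).1 m = f m • (D X σ).1 m + 𝒢.anchorDeriv X.1 f m • σ.1 m := by
  obtain ⟨Y, rfl⟩ := 𝒢.bar_surjective σ
  have h1 : f • 𝒢.bar F Y = 𝒢.bar F (f • Y) := rfl
  refine qMetric_ext_sec fun Z => ?_
  rw [h1, hD.qMetric_mk, map_add, map_smul, map_smul, LinearMap.add_apply, LinearMap.smul_apply,
    LinearMap.smul_apply, hD.qMetric_mk]
  refine (𝒢.triple_smul_middle h.critical X Y Z f m).trans ?_
  rw [h.metric_eq]
  rfl

lemma add_left (hD : 𝒢.IsInducedBy F Φ D) (X X' : 𝒢.Sec) (σ : 𝒢.QSec F) :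
    D (X + X') σ = D X σ + D X' σ := by
  obtain ⟨Y, rfl⟩ := 𝒢.bar_surjective σ
  refine Subtype.ext (funext fun m => qMetric_ext_sec fun Z => ?_)
  change _ = 𝒢.qMetric F m ((D X (𝒢.bar F Y)).1 m + (D X' (𝒢.bar F Y)).1 m) _
  rw [map_add, LinearMap.add_apply, hD.qMetric_mk, hD.qMetric_mk, hD.qMetric_mk]
  exact congrFun (𝒢.vderiv_leftInv_add X.1 X'.1 _) (𝒢.unit m)

lemma add_right (hD : 𝒢.IsInducedBy F Φ D) (X : 𝒢.Sec) (σ τ : 𝒢.QSec F) :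
    D X (σ + τ) = D X σ + D X τ := by
  obtain ⟨Y, rfl⟩ := 𝒢.bar_surjective σ
  obtain ⟨Y', rfl⟩ := 𝒢.bar_surjective τ
  have h1 : 𝒢.bar F Y + 𝒢.bar F Y' = 𝒢.bar F (Y + Y') := rfl
  refine Subtype.ext (funext fun m => qMetric_ext_sec fun Z => ?_)
  change _ = 𝒢.qMetric F m ((D X (𝒢.bar F Y)).1 m + (D X (𝒢.bar F Y')).1 m) _
  rw [map_add, LinearMap.add_apply, h1, hD.qMetric_mk, hD.qMetric_mk, hD.qMetric_mk]
  exact 𝒢.triple_add_middle X Y Y' Z m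

lemma isEConnection (hD : 𝒢.IsInducedBy F Φ D) (h : 𝒢.IsKoszulPotential F Φ) :
    𝒢.IsEConnection F D where
  add_left := hD.add_left
  add_right := hD.add_right
  real_smul_left c X σ := Subtype.ext (funext fun m =>
    hD.apply_smul_left (fun _ => c) X (c • X) (fun _ => rfl) σ m)
  real_smul_right c X σ := by
    refine Subtype.ext (funext fun m => ?_)
    -- Real homogeneity is the Leibniz rule for a constant function.
    have h1 := hD.leibniz h (ContMDiffMap.const c) X σ m
    have h2 : 𝒢.anchorDeriv X.1 (fun _ => c) m = 0 :=
      DFunLike.congr_fun (mfderiv_const (I := 𝓘(ℝ, EM)) (I' := 𝓘(ℝ, ℝ)) (c := c) (x := m)) _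
    have h3 : c • (D X σ).1 m + 𝒢.anchorDeriv X.1 (fun _ => c) m • σ.1 m = c • (D X σ).1 m := by
      rw [h2, zero_smul, add_zero]
    exact h1.trans h3
  smul_left f X σ := Subtype.ext (funext fun m =>
    hD.apply_smul_left f X (f • X) (fun _ => rfl) σ m)
  leibniz := hD.leibniz h

lemma isTorsionFree (hD : 𝒢.IsInducedBy F Φ D) (h : 𝒢.IsKoszulPotential F Φ) :
    𝒢.IsTorsionFree F D := by
  intro X Y m
  refine qMetric_ext_sec fun Z => ?_
  have : CompleteSpace EG := FiniteDimensional.complete ℝ EG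
  rw [map_sub, LinearMap.sub_apply, hD.qMetric_mk, hD.qMetric_mk, LieGroupoid.qMetric_mk,
    ← h.metric_eq, 𝒢.metric_bracket h.critical]

lemma areDual {D' : 𝒢.Sec → 𝒢.QSec F → 𝒢.QSec F} (hD : 𝒢.IsInducedBy F Φ D)
    (hD' : 𝒢.IsInducedBy F (𝒢.starFun Φ) D') (h : 𝒢.IsKoszulPotential F Φ) :
    𝒢.AreDual F D D' := by
  intro X σ τ m
  obtain ⟨Y, rfl⟩ := 𝒢.bar_surjective σ
  obtain ⟨Z, rfl⟩ := 𝒢.bar_surjective τ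
  rw [qMetric_symm m _ ((D' X (𝒢.bar F Z)).1 m)]
  have h1 : (fun p => 𝒢.qMetric F p ((𝒢.bar F Y).1 p) ((𝒢.bar F Z).1 p)) =
      fun p => 𝒢.metric Φ p (Y.1 p) (Z.1 p) := by
    funext p
    rw [h.metric_eq]
    rfl
  rw [h1, 𝒢.anchorDeriv_metric h.critical X Y Z m]
  exact congrArg₂ (· + ·) (hD X Y Z m).symm (hD' X Z Y m).symm

end IsInducedBy

end Connection

end LieGroupoid

/-! ### The theorem -/

theorem theoremt1 {EG EM : Type*} [NormedAddCommGroup EG] [NormedSpace ℝ EG]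
    [FiniteDimensional ℝ EG] [NormedAddCommGroup EM] [NormedSpace ℝ EM] [FiniteDimensional ℝ EM]
    {G M : Type*} [TopologicalSpace G] [ChartedSpace EG G] [IsManifold 𝓘(ℝ, EG) ∞ G]
    [T2Space G] [SecondCountableTopology G]
    [TopologicalSpace M] [ChartedSpace EM M] [IsManifold 𝓘(ℝ, EM) ∞ M]
    [T2Space M] [SecondCountableTopology M]
    (𝒢 : LieGroupoid EG EM G M) (F : C^∞⟮𝓘(ℝ, EG), G; 𝓘(ℝ, ℝ), ℝ⟯)
    (hF : 𝒢.IsKoszulContrast F) :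
    (∃! D : 𝒢.Sec → 𝒢.QSec F → 𝒢.QSec F, 𝒢.IsInducedBy F F D) ∧
    (∃! D : 𝒢.Sec → 𝒢.QSec F → 𝒢.QSec F, 𝒢.IsInducedBy F (𝒢.starFun F) D) ∧
    ∀ D D' : 𝒢.Sec → 𝒢.QSec F → 𝒢.QSec F,
      𝒢.IsInducedBy F F D → 𝒢.IsInducedBy F (𝒢.starFun F) D' →
      𝒢.IsEConnection F D ∧ 𝒢.IsEConnection F D' ∧ 𝒢.AreDual F D D' ∧
      𝒢.IsTorsionFree F D ∧ 𝒢.IsTorsionFree F D' := by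
  have h := hF.isKoszulPotential
  have hs := hF.isKoszulPotential_starFun
  obtain ⟨D, hD⟩ := h.exists_isInducedBy
  obtain ⟨D', hD'⟩ := hs.exists_isInducedBy
  exact ⟨⟨D, hD, fun _ hE => hE.eq hD⟩, ⟨D', hD', fun _ hE => hE.eq hD'⟩, fun _ _ hE hE' =>
    ⟨hE.isEConnection h, hE'.isEConnection hs, hE.areDual hE' h, hE.isTorsionFree h,
      hE'.isTorsionFree hs⟩⟩

end
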